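/- Let $A$ be a finite alphabet. A \emph{prevariety} is a set $\mathcal C$ of regular languages over $A$ that contains $\emptyset$ and $A^*$, is closed under union, intersection and complement, and contains $u^{-1}L=\{w : uw\in L\}$ and $Lu^{-1}=\{w : wu\in L\}$ for all $L\in\mathcal C$ and $u\in A^*$. For $K,L\subseteq A^*$ and $a\in A$, the marked concatenation $KaL=\{uav : u\in K,\ v\in L\}$ is \emph{unambiguous} if $uav=u'av'$ with $u,u'\in K$ and $v,v'\in L$ implies $u=u'$ and $v=v'$. The \emph{unambiguous polynomial closure} $\mathit{UPol}(\mathcal C)$ is the least set of languages that contains $\mathcal C$ and is closed under disjoint union and unambiguous marked concatenation. Let $\mathcal D$ be a set of languages over $A$. The \emph{$\mathcal D$-separation problem} takes two regular languages $L_1,L_2$ as input and asks whether there is $K\in\mathcal D$ with $L_1\subseteq K$ and $K\cap L_2=\emptyset$. The \emph{$\mathcal D$-covering problem} takes as input a regular language $L_1$ and a finite set $\mathbf L_2$ of regular languages, and asks whether there is a finite set $\mathbf K\subseteq\mathcal D$ such that $L_1\subseteq\bigcup_{K\in\mathbf K}K$ and for every $K\in\mathbf K$ there is $L\in\mathbf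 L_2$ with $K\cap L=\emptyset$. Input languages are given by nondeterministic finite automata. \textbf{Corollary.} For every finite prevariety $\mathcal C$ (that is, a prevariety with finitely many elements), the $\mathit{UPol}(\mathcal C)$-covering problem and the $\mathit{UPol}(\mathcal C)$-separation problem are both decidable. -/

import Mathlib

namespace UPolCov

/-- The right quotient `L u⁻¹` (the left one `u⁻¹ L` is `Language.leftQuotient`). -/
def rightQuotient {A : Type*} (L : Language A) (u : List A) : Language A := {w | w ++ u ∈ L}

/-- A prevariety over the alphabet `A`: a class of regular languages which is a Boolean algebra
(it contains `∅` and `A*`, and is closed under union, intersection and complement) and is closed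
under left and right quotients by words. -/
structure IsPrevariety {A : Type*} (C : Set (Language A)) : Prop where
  empty_mem : (⊥ : Language A) ∈ C
  univ_mem : (⊤ : Language A) ∈ C
  union_mem : ∀ K ∈ C, ∀ L ∈ C, K ⊔ L ∈ C
  inter_mem : ∀ K ∈ C, ∀ L ∈ C, K ⊓ L ∈ C
  compl_mem : ∀ L ∈ C, Lᶜ ∈ C
  leftQuotient_mem : ∀ L ∈ C, ∀ u : List A, L.leftQuotient u ∈ C
  rightQuotient_mem : ∀ L ∈ C, ∀ u : List A, rightQuotient L u ∈ C
  regular : ∀ L ∈ C, L.IsRegular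

/-- The marked concatenation `K a L`. -/
def markedConcat {A : Type*} (K : Language A) (a : A) (L : Language A) : Language A :=
  {w | ∃ u ∈ K, ∃ v ∈ L, w = u ++ a :: v}

/-- The marked concatenation `K a L` is unambiguous: each of its words has a unique
decomposition `u a v` with `u ∈ K` and `v ∈ L`. -/
def Unambiguous {A : Type*} (K : Language A) (a : A) (L : Language A) : Prop :=
  ∀ u ∈ K, ∀ u' ∈ K, ∀ v ∈ L, ∀ v' ∈ L, u ++ a :: v = u' ++ a :: v' → u = u' ∧ v = v'

/-- Membership in the unambiguous polynomial closure of `C`: the least class containing `C` and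
closed under disjoint union and unambiguous marked concatenation. -/
inductive InUPol {A : Type*} (C : Set (Language A)) : Language A → Prop
  | base (L : Language A) : L ∈ C → InUPol C L
  | disjUnion (K L : Language A) : InUPol C K → InUPol C L → K ⊓ L = ⊥ → InUPol C (K ⊔ L)
  | concat (K : Language A) (a : A) (L : Language A) :
      InUPol C K → InUPol C L → Unambiguous K a L → InUPol C (markedConcat K a L)

/-- The unambiguous polynomial closure of `C`, as a class of languages. -/
def UPol {A : Type*} (C : Set (Language A)) : Set (Language A) := {L | InUPol C L}

/-- `L₁` is `D`-separable from `L₂`: some `K ∈ D` includes `L₁` and is disjoint from `L₂`. -/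
def Separable {A : Type*} (D : Set (Language A)) (L₁ L₂ : Language A) : Prop :=
  ∃ K ∈ D, L₁ ≤ K ∧ L₂ ⊓ K = ⊥

/-- The pair `(L₁, L₂s)` is `D`-coverable: there is a finite set `Ks` of languages of `D` whose union
includes `L₁`, and each `K ∈ Ks` is disjoint from at least one `L ∈ L₂s`. -/
def Coverable {A : Type*} (D : Set (Language A)) (L₁ : Language A) (L₂s : Set (Language A)) :
    Prop :=
  ∃ Ks : Set (Language A), Ks.Finite ∧ Ks ⊆ D ∧ (∀ w ∈ L₁, ∃ K ∈ Ks, w ∈ K) ∧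
    ∀ K ∈ Ks, ∃ L ∈ L₂s, K ⊓ L = ⊥

/-- A finite description of a nondeterministic finite automaton whose states are natural numbers:
the lists of its transitions `(p, a, q)`, of its initial states and of its final states. (Only the
finitely many states that occur in these lists play a role.) -/
abbrev NFACode (A : Type*) : Type _ := List (ℕ × A × ℕ) × List ℕ × List ℕ

/-- The automaton described by a code. -/
def NFACode.toNFA {A : Type*} (c : NFACode A) : NFA A ℕ where
  step p a := {q | (p, a, q) ∈ c.1}
  start := {q | q ∈ c.2.1}
  accept := {q | q ∈ c.2.2}

/-- The language recognized by the automaton that a code describes. -/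
def NFACode.lang {A : Type*} (c : NFACode A) : Language A := (NFACode.toNFA c).accepts

/-- The regular languages over a finite alphabet are exactly the languages that have a code. -/
theorem isRegular_iff_exists_code {A : Type*} [Finite A] (L : Language A) :
    L.IsRegular ↔ ∃ c : NFACode A, NFACode.lang c = L := by
  constructor
  · rintro ⟨σ, _, M, rfl⟩
    classical
    have := Fintype.ofFinite A
    let e : σ → ℕ := fun s => (Fintype.equivFin σ s : ℕ)
    have he : Function.Injective e := fun s t h =>
      (Fintype.equivFin σ).injective (Fin.ext h)
    let c : NFACode A :=
      ((Finset.univ : Finset (σ × A)).toList.map (fun p => (e p.1, p.2, e (M.step p.1 p.2))),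
        [e M.start], ((Finset.univ : Finset σ).filter (· ∈ M.accept)).toList.map e)
    have hstep : ∀ s a, (NFACode.toNFA c).stepSet {e s} a = {e (M.step s a)} := by
      intro s a
      ext q
      simp only [NFA.stepSet_singleton, NFACode.toNFA, c, Set.mem_ofPred_eq, List.mem_map,
        Finset.mem_toList, Finset.mem_univ, true_and, Prod.mk.injEq, Set.mem_singleton_iff]
      constructor
      · rintro ⟨⟨s', a'⟩, h1, rfl, rfl⟩
        rw [he h1]
      · rintro rfl
        exact ⟨(s, a), rfl, rfl, rfl⟩
    have heval : ∀ (w : List A) s,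
        (NFACode.toNFA c).evalFrom {e s} w = {e (M.evalFrom s w)} := by
      intro w
      induction w with
      | nil => intro s; rfl
      | cons a w ih => intro s; rw [NFA.evalFrom_cons, hstep, ih]; rfl
    have hstart : (NFACode.toNFA c).start = {e M.start} := by
      ext q; simp [NFACode.toNFA, c]
    refine ⟨c, ?_⟩
    ext w
    rw [NFACode.lang, NFA.mem_accepts, hstart, heval, DFA.mem_accepts]
    simp only [Set.mem_singleton_iff, exists_eq_right]
    simp only [NFACode.toNFA, c, Set.mem_ofPred_eq, List.mem_map, Finset.mem_toList,
      Finset.mem_filter, Finset.mem_univ, true_and]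
    constructor
    · rintro ⟨s, hs, h⟩
      rw [he h] at hs
      exact hs
    · intro h
      exact ⟨_, h, rfl⟩
  · rintro ⟨c, rfl⟩
    apply Language.IsRegular.of_finite_range_leftQuotient
    let T : Set ℕ := {q | q ∈ c.2.1 ++ c.1.map (fun t => t.2.2)}
    have hT : T.Finite := List.finite_toSet _
    have hsub : ∀ (w : List A) (S : Set ℕ), S ⊆ T → (NFACode.toNFA c).evalFrom S w ⊆ T := by
      intro w
      induction w with
      | nil => intro S hS; exact hS
      | cons a w ih =>
        intro S _
        rw [NFA.evalFrom_cons]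
        apply ih
        intro q hq
        rw [NFA.mem_stepSet] at hq
        obtain ⟨p, _, hp⟩ := hq
        exact List.mem_append_right _ (List.mem_map.2 ⟨_, hp, rfl⟩)
    refine (hT.finite_subsets.image (NFACode.toNFA c).acceptsFrom).subset ?_
    rintro _ ⟨w, rfl⟩
    refine ⟨(NFACode.toNFA c).evalFrom (NFACode.toNFA c).start w,
      hsub w _ (fun q hq => List.mem_append_left _ hq), ?_⟩
    ext v
    rw [Language.mem_leftQuotient, NFACode.lang, NFA.accepts_eq_acceptsFrom_start,
      NFA.append_mem_acceptsFrom]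

/-- The `D`-separation problem is decidable: an algorithm decides, given automata for two regular
languages `L₁` and `L₂`, whether `L₁` is `D`-separable from `L₂`. -/
def SeparationDecidable {A : Type*} [Primcodable A] (D : Set (Language A)) : Prop :=
  ComputablePred fun p : NFACode A × NFACode A =>
    Separable D (NFACode.lang p.1) (NFACode.lang p.2)

/-- The `D`-covering problem is decidable: an algorithm decides, given an automaton for a regular
language `L₁` and a list of automata for a finite set `L₂s` of regular languages, whether
`(L₁, L₂s)` is `D`-coverable. -/
def CoveringDecidable {A : Type*} [Primcodable A] (D : Set (Language A)) : Prop :=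
  ComputablePred fun p : NFACode A × List (NFACode A) =>
    Coverable D (NFACode.lang p.1) {L | ∃ c ∈ p.2, NFACode.lang c = L}

end UPolCov

namespace UPolCov

/-! Words that belong to the same languages of the finite prevariety form the classes of a
congruence of finite index. This gives a morphism `f` onto a finite monoid `N` that recognizes every
language of `C` and whose fibres lie in `C`. The theorem then rests on three facts.

Necessity: every language of `UPol C` satisfies an equation `u ^ p w u ^ p = u ^ p` in its syntactic
congruence, for words `u`, `w` with the same idempotent value (`InUPol.exists_absorbs`). In an
unambiguous product, a marked letter between two long powers could be moved to another copy of its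
surroundings, which would give a second decomposition.

Sufficiency: start with the fibres of `f` and refine repeatedly, cutting each word at the place
where a suffix, then a prefix, enters the ideal of the value of the word. The cut depends only on
the values of the two factors, so all products are unambiguous and the resulting finite partitions
`classes f k` lie in `UPol C`. Conversely, by induction along the J-order of `N`, the absorption
equation forces each language of `UPol C` to be a union of classes of every large enough depth
(`Absorbs.exists_pure`). Hence covering holds if and only if, at some depth, every class that meets
`L₁` misses some language of `L₂s` (`coverable_iff`).

Effectiveness: whether a class meets an input language depends only on its image in a finite monoid
`M` that recognizes all inputs. The images shrink with the depth and are stable from a depth bounded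
by the size of `N × Set M` (`imgLE_classes_of_card`). Short words realize all images, so the classes
can be replaced by explicit finite languages, and the test becomes primitive recursive. -/

/-- The value of a word under the monoid morphism that extends `f`. -/
def val {A N : Type*} [Monoid N] (f : A → N) (w : List A) : N := (w.map f).prod

/-! ### Values and powers of words -/

section val

variable {A N : Type*} [Monoid N] (f : A → N)

@[simp] theorem val_nil : val f [] = 1 := by simp [val]

@[simp] theorem val_cons (a : A) (w : List A) : val f (a :: w) = f a * val f w := by simp [val]

@[simp] theorem val_append (u v : List A) : val f (u ++ v) = val f u * val f v := by simp [val]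

end val

/-- The power `u ^ n` of a word. -/
def wpow {A : Type*} (u : List A) : ℕ → List A
  | 0 => []
  | n + 1 => u ++ wpow u n

section wpow

variable {A : Type*} (u : List A)

theorem wpow_succ (n : ℕ) : wpow u (n + 1) = u ++ wpow u n := rfl

theorem wpow_one : wpow u 1 = u := by simp [wpow]

theorem wpow_add (m n : ℕ) : wpow u (m + n) = wpow u m ++ wpow u n := by
  induction m with
  | zero => simp [wpow]
  | succ m ih => rw [Nat.succ_add, wpow_succ, wpow_succ, ih, List.append_assoc]

theorem val_wpow {N : Type*} [Monoid N] (f : A → N) (n : ℕ) :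
    val f (wpow u n) = val f u ^ n := by
  induction n with
  | zero => simp [wpow]
  | succ n ih => rw [wpow_succ, val_append, ih, pow_succ']

variable {u}

/-- A letter of `u ^ q` lies in one of the `q` copies of `u`. -/
theorem wpow_eq_append_cons {q : ℕ} {k l : List A} {a : A} (h : wpow u q = k ++ a :: l) :
    ∃ i j u₁ u₂, i + j + 1 = q ∧ u = u₁ ++ a :: u₂ ∧ k = wpow u i ++ u₁ ∧ l = u₂ ++ wpow u j := by
  induction q generalizing k with
  | zero => simp [wpow] at h
  | succ q ih =>
    rw [wpow_succ, List.append_eq_append_iff] at h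
    obtain ⟨k', rfl, h⟩ | ⟨c, hu, hc⟩ := h
    · obtain ⟨i, j, u₁, u₂, rfl, h1, rfl, rfl⟩ := ih h
      exact ⟨i + 1, j, u₁, u₂, by omega, h1, by simp [wpow_succ], rfl⟩
    · rcases c with _ | ⟨b, c⟩
      · simp only [List.nil_append] at hc
        obtain ⟨i, j, u₁, u₂, rfl, h1, h2, rfl⟩ := ih (k := []) hc.symm
        refine ⟨i + 1, j, u₁, u₂, by omega, h1, ?_, rfl⟩
        rw [wpow_succ, List.append_assoc, ← h2, hu]
        simp
      · simp only [List.cons_append, List.cons.injEq] at hc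
        obtain ⟨rfl, rfl⟩ := hc
        exact ⟨0, q, k, c, by omega, hu, by simp [wpow], rfl⟩

end wpow

/-! ### The absorption equation and its stability under unambiguous products -/

/-- The syntactic congruence of a language. -/
def SynEq {A : Type*} (L : Language A) (u v : List A) : Prop :=
  ∀ x y, x ++ (u ++ y) ∈ L ↔ x ++ (v ++ y) ∈ L

namespace SynEq

variable {A : Type*} {L : Language A} {u v w u' v' : List A}

theorem refl (L : Language A) (u : List A) : SynEq L u u := fun _ _ => Iff.rfl

theorem symm (h : SynEq L u v) : SynEq L v u := fun x y => (h x y).symm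

theorem trans (h : SynEq L u v) (h' : SynEq L v w) : SynEq L u w :=
  fun x y => (h x y).trans (h' x y)

theorem append (h : SynEq L u v) (h' : SynEq L u' v') : SynEq L (u ++ u') (v ++ v') := by
  intro x y
  rw [List.append_assoc, List.append_assoc, h x (u' ++ y), ← List.append_assoc x v,
    ← List.append_assoc x v, h' (x ++ v) y]

theorem append_left (h : SynEq L u v) (x : List A) : SynEq L (x ++ u) (x ++ v) :=
  (refl L x).append h

theorem append_right (h : SynEq L u v) (x : List A) : SynEq L (u ++ x) (v ++ x) :=
  h.append (refl L x)

theorem mem_iff (h : SynEq L u v) : u ∈ L ↔ v ∈ L := by simpa using h [] []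

end SynEq

/-- The equation `u ^ p w u ^ p = u ^ p` of the syntactic congruence of `L`, for all words `u`, `w`
with the same idempotent value. -/
def Absorbs {A N : Type*} [Monoid N] (f : A → N) (L : Language A) (p : ℕ) : Prop :=
  ∀ u w : List A, IsIdempotentElem (val f u) → val f w = val f u →
    SynEq L (wpow u p ++ (w ++ wpow u p)) (wpow u p)

section Absorbs

variable {A N : Type*} [Monoid N] {f : A → N} {L K : Language A} {p : ℕ}

/-- Absorbing `w = u` and `w = u ++ u` in turn shows that `u ^ p` and `u ^ (p + 1)` are equivalent:
the word `u ^ p (u u) u ^ p` is `(u ^ p u u ^ p) u`. -/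
theorem Absorbs.wpow_synEq (h : Absorbs f L p) {u : List A} (hu : IsIdempotentElem (val f u))
    {i : ℕ} (hi : p ≤ i) : SynEq L (wpow u i) (wpow u p) := by
  have h1 := h u u hu rfl
  have h2 := h u (u ++ u) hu (by rw [val_append, hu.eq])
  have h3 : SynEq L (wpow u (p + 1)) (wpow u p) := by
    have e1 : wpow u p ++ ((u ++ u) ++ wpow u p) = (wpow u p ++ (u ++ wpow u p)) ++ u := by
      have : u ++ wpow u p = wpow u p ++ u := by
        rw [← wpow_succ, wpow_add, wpow_one]
      simp only [List.append_assoc, ← this]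
    rw [wpow_add, wpow_one]
    rw [e1] at h2
    exact (h1.append_right u).symm.trans h2
  obtain ⟨n, rfl⟩ := Nat.exists_eq_add_of_le hi
  induction n with
  | zero => exact SynEq.refl _ _
  | succ n ih =>
    refine SynEq.trans ?_ (ih (by omega))
    have := h3.append_right (wpow u n)
    rwa [← wpow_add, ← wpow_add, Nat.add_assoc, Nat.add_comm 1] at this

theorem Absorbs.absorb (h : Absorbs f L p) {u w : List A} (hu : IsIdempotentElem (val f u))
    (hw : val f w = val f u) {i j k : ℕ} (hi : p ≤ i) (hj : p ≤ j) (hk : p ≤ k) :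
    SynEq L (wpow u i ++ (w ++ wpow u j)) (wpow u k) :=
  ((h.wpow_synEq hu hi).append ((h.wpow_synEq hu hj).append_left w)).trans
    ((h u w hu hw).trans (h.wpow_synEq hu hk).symm)

theorem Absorbs.mono (h : Absorbs f L p) {q : ℕ} (hq : p ≤ q) : Absorbs f L q :=
  fun _ _ hu hw => h.absorb hu hw hq hq hq

theorem Absorbs.of_saturated (h : ∀ u v, val f u = val f v → (u ∈ L ↔ v ∈ L)) :
    Absorbs f L 1 := by
  intro u w hu hw x y
  apply h
  simp only [wpow_one, val_append, hw]
  rw [← mul_assoc (val f u) (val f u) (val f u), hu.eq, hu.eq]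

theorem Absorbs.union (hK : Absorbs f K p) (hL : Absorbs f L p) : Absorbs f (K ⊔ L) p :=
  fun u w hu hw x y => or_congr (hK u w hu hw x y) (hL u w hu hw x y)

/-- The marked letter of an unambiguous product cannot be surrounded by long powers. -/
theorem Unambiguous.not_surrounded {a : A} (hun : Unambiguous K a L) (hK : Absorbs f K p)
    (hL : Absorbs f L p) {u x y z₁ z₂ : List A} (hu : IsIdempotentElem (val f u))
    (hz : val f (z₁ ++ a :: z₂) = val f u) {i j : ℕ} (hi : p ≤ i) (hj : p ≤ j)
    (h1 : x ++ (wpow u i ++ z₁) ∈ K) (h2 : z₂ ++ (wpow u j ++ y) ∈ L) : False := by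
  -- With `z = z₁ a z₂`, the word `x u^i z u^j z u^j y` can be split at the marked letter of either
  -- copy of `z`: absorption in `K` covers the second copy, absorption in `L` the first. The two
  -- prefixes have different lengths.
  have h3 := (hK.absorb hu hz hi hj hi x z₁).2 h1
  have h4 := (hL.absorb hu hz hj hj hj z₂ y).2 h2
  have := (hun _ h1 _ h3 _ h4 _ h2 (by simp)).1
  have := congrArg List.length this
  simp at this

theorem mul_pow_idem {e : N} (he : IsIdempotentElem e) (i : ℕ) : e * e ^ i = e := by
  rw [← pow_succ', he.pow_succ_eq]

theorem pow_mul_idem {e : N} (he : IsIdempotentElem e) (i : ℕ) : e ^ i * e = e := by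
  rw [← pow_succ, he.pow_succ_eq]

/-- A letter of a word `x u y`, located in one of the factors. -/
theorem append_append_eq_append_cons {x y z k l : List A} {a : A}
    (h : x ++ (y ++ z) = k ++ a :: l) :
    (∃ x', x = k ++ a :: x' ∧ l = x' ++ (y ++ z)) ∨
    (∃ y₁ y₂, y = y₁ ++ a :: y₂ ∧ k = x ++ y₁ ∧ l = y₂ ++ z) ∨
    (∃ z', z = z' ++ a :: l ∧ k = x ++ (y ++ z')) := by
  have aux : ∀ {x y k : List A}, x ++ y = k ++ a :: l →
      (∃ x', x = k ++ a :: x' ∧ l = x' ++ y) ∨ (∃ z', y = z' ++ a :: l ∧ k = x ++ z') := by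
    intro x y k h
    rw [List.append_eq_append_iff] at h
    obtain ⟨c, rfl, rfl⟩ | ⟨c, rfl, hc⟩ := h
    · exact Or.inr ⟨c, rfl, rfl⟩
    · rcases c with _ | ⟨b, c⟩
      · exact Or.inr ⟨[], by simpa using hc.symm, by simp⟩
      · simp only [List.cons_append, List.cons.injEq] at hc
        obtain ⟨rfl, rfl⟩ := hc
        exact Or.inl ⟨c, rfl, rfl⟩
  obtain h | ⟨z', h', rfl⟩ := aux h
  · exact Or.inl h
  · obtain ⟨y', h1, h2⟩ | ⟨z'', rfl, rfl⟩ := aux h'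
    · exact Or.inr (Or.inl ⟨_, _, h1, rfl, h2⟩)
    · exact Or.inr (Or.inr ⟨_, rfl, rfl⟩)

/-- If the marked letter falls outside the part to be rewritten, the equation of one factor
suffices. If it falls in a copy of `u` within a power `u ^ (2p + 1)`, then `2p` copies remain around
it, so at least `p` lie on one side. Either the letter is surrounded by long powers, which
unambiguity excludes, or the side that contains `w` (or is to receive it) still has `p` copies, and
the rewriting takes place there. A letter in `w` is always surrounded. -/
theorem Absorbs.concat {a : A} (hun : Unambiguous K a L) (hK : Absorbs f K p)
    (hL : Absorbs f L p) : Absorbs f (markedConcat K a L) (2 * p + 1) := by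
  intro u w hu hw x y
  set q := 2 * p + 1 with hq
  constructor
  · rintro ⟨k, hk, l, hl, h⟩
    rcases append_append_eq_append_cons h with
      ⟨x', rfl, rfl⟩ | ⟨t₁, t₂, ht, rfl, rfl⟩ | ⟨y', rfl, rfl⟩
    · exact ⟨k, hk, x' ++ (wpow u q ++ y),
        (hL.absorb hu hw (i := q) (j := q) (k := q) (by omega) (by omega) (by omega) x' y).1 hl, by simp⟩
    · rcases append_append_eq_append_cons ht with
        ⟨u', hu', rfl⟩ | ⟨w₁, w₂, rfl, rfl, rfl⟩ | ⟨u', hu', rfl⟩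
      · obtain ⟨i, j, u₁, u₂, hij, hu₁, rfl, rfl⟩ := wpow_eq_append_cons hu'
        have hsplit : wpow u q = wpow u i ++ (u₁ ++ a :: (u₂ ++ wpow u j)) := by simpa using hu'
        by_cases hi : p ≤ i
        · refine (hun.not_surrounded hK hL (x := x) (y := y) (z₁ := u₁)
            (z₂ := u₂ ++ (wpow u j ++ w)) (i := i) (j := q) hu ?_ hi (by omega) hk
            (by simpa using hl)).elim
          have : u₁ ++ a :: (u₂ ++ (wpow u j ++ w)) = u ++ (wpow u j ++ w) := by simp [hu₁]
          rw [this, val_append f u, val_append, hw, val_wpow, pow_mul_idem hu, hu.eq]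
        · refine ⟨_, hk, u₂ ++ (wpow u j ++ y), ?_, by
            rw [hsplit]; simp⟩
          exact (hL.absorb hu hw (i := j) (j := q) (k := j) (by omega) (by omega) (by omega) u₂ y).1 (by simpa using hl)
      · refine (hun.not_surrounded hK hL (x := x) (y := y) (z₁ := w₁) (z₂ := w₂) (i := q) (j := q)
          hu hw (by omega) (by omega) hk (by simpa using hl)).elim
      · obtain ⟨i, j, u₁, u₂, hij, hu₁, rfl, rfl⟩ := wpow_eq_append_cons hu'
        have hsplit : wpow u q = wpow u i ++ (u₁ ++ a :: (u₂ ++ wpow u j)) := by simpa using hu'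
        by_cases hj : p ≤ j
        · refine (hun.not_surrounded hK hL (x := x) (y := y) (z₁ := w ++ (wpow u i ++ u₁))
            (z₂ := u₂) (i := q) (j := j) hu ?_ (by omega) hj (by simpa using hk)
            (by simpa using hl)).elim
          have : (w ++ (wpow u i ++ u₁)) ++ a :: u₂ = w ++ (wpow u i ++ u) := by simp [hu₁]
          rw [this, val_append, val_append, hw, val_wpow, pow_mul_idem hu, hu.eq]
        · refine ⟨x ++ (wpow u i ++ u₁), ?_, _, hl, ?_⟩
          · exact (hK.absorb hu hw (i := q) (j := i) (k := i) (by omega) (by omega) (by omega) x u₁).1 (by simpa using hk)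
          · rw [hsplit]; simp
    · exact ⟨x ++ (wpow u q ++ y'),
        (hK.absorb hu hw (i := q) (j := q) (k := q) (by omega) (by omega) (by omega) x y').1 (by simpa using hk), l, hl,
        by simp⟩
  · rintro ⟨k, hk, l, hl, h⟩
    rcases append_append_eq_append_cons h with
      ⟨x', rfl, rfl⟩ | ⟨t₁, t₂, ht, rfl, rfl⟩ | ⟨y', rfl, rfl⟩
    · exact ⟨k, hk, x' ++ ((wpow u q ++ (w ++ wpow u q)) ++ y),
        (hL.absorb hu hw (i := q) (j := q) (k := q) (by omega) (by omega) (by omega) x' y).2 hl, by simp⟩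
    · obtain ⟨i, j, u₁, u₂, hij, hu₁, rfl, rfl⟩ := wpow_eq_append_cons ht
      have hsplit : wpow u q = wpow u i ++ (u₁ ++ a :: (u₂ ++ wpow u j)) := by simpa using ht
      by_cases hj : p ≤ j
      · by_cases hi : p ≤ i
        · exact (hun.not_surrounded hK hL (x := x) (y := y) hu (congrArg _ hu₁.symm) hi hj hk (by simpa using hl)).elim
        · refine ⟨x ++ (wpow u i ++ u₁), hk, u₂ ++ ((wpow u j ++ (w ++ wpow u q)) ++ y),
            (hL.absorb hu hw (i := j) (j := q) (k := j) (by omega) (by omega) (by omega) u₂ y).2 (by simpa using hl), ?_⟩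
          rw [hsplit]; simp
      · refine ⟨x ++ ((wpow u q ++ (w ++ wpow u i)) ++ u₁),
            (hK.absorb hu hw (i := q) (j := i) (k := i) (by omega) (by omega) (by omega) x u₁).2 (by simpa using hk), _, hl, ?_⟩
        nth_rw 2 [hsplit]; simp
    · exact ⟨x ++ ((wpow u q ++ (w ++ wpow u q)) ++ y'),
        (hK.absorb hu hw (i := q) (j := q) (k := q) (by omega) (by omega) (by omega) x y').2 (by simpa using hk), l, hl,
        by simp⟩

end Absorbs

/-! ### Recognition by finite monoids; regularity and absorption in the closure -/

/-- The morphism that extends `g` recognizes the language `L`. -/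
def Recognizes {A M : Type*} [Monoid M] (g : A → M) (L : Language A) : Prop :=
  ∀ u v, val g u = val g v → (u ∈ L ↔ v ∈ L)

theorem Recognizes.synEq {A M : Type*} [Monoid M] {g : A → M} {L : Language A}
    (h : Recognizes g L) {u v : List A} (huv : val g u = val g v) : SynEq L u v := by
  intro x y
  apply h
  simp [huv]

/-- The transition morphism of a deterministic automaton. -/
def dfaMor {A σ : Type*} (D : DFA A σ) (a : A) : (Function.End σ)ᵐᵒᵖ :=
  MulOpposite.op fun s => D.step s a

theorem val_dfaMor {A σ : Type*} (D : DFA A σ) (w : List A) (s : σ) :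
    (val (dfaMor D) w).unop s = D.evalFrom s w := by
  induction w generalizing s with
  | nil => simp; rfl
  | cons a w ih =>
    rw [val_cons, MulOpposite.unop_mul, DFA.evalFrom_cons, ← ih]
    rfl

theorem recognizes_dfaMor {A σ : Type*} (D : DFA A σ) : Recognizes (dfaMor D) D.accepts := by
  intro u v h
  have : D.evalFrom D.start u = D.evalFrom D.start v := by
    rw [← val_dfaMor, ← val_dfaMor, h]
  change D.evalFrom D.start u ∈ D.accept ↔ D.evalFrom D.start v ∈ D.accept
  rw [this]

instance finite_end_op (σ : Type*) [Finite σ] : Finite (Function.End σ)ᵐᵒᵖ :=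
  Finite.of_equiv (σ → σ) MulOpposite.opEquiv

theorem exists_recognizes_of_isRegular {A : Type*} {L : Language A} (h : L.IsRegular) :
    ∃ (M : Type) (_ : Monoid M) (_ : Finite M) (g : A → M), Recognizes g L := by
  obtain ⟨σ, _, D, rfl⟩ := h
  exact ⟨_, inferInstance, inferInstance, dfaMor D, recognizes_dfaMor D⟩

/-- The marked concatenation of regular languages is regular. -/
theorem isRegular_markedConcat {A : Type*} {K L : Language A} (hK : K.IsRegular)
    (hL : L.IsRegular) (a : A) : (markedConcat K a L).IsRegular := by
  apply Language.IsRegular.of_finite_range_leftQuotient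
  have h1 := hK.finite_range_leftQuotient
  have h2 := hL.finite_range_leftQuotient.finite_subsets
  -- A quotient of the product by `w` is determined by one quotient of `K` (marked letter after `w`)
  -- and a set of quotients of `L` (marked letter inside `w`), so there are finitely many.
  let F : Language A × Set (Language A) → Language A := fun p =>
    {x | x ∈ markedConcat p.1 a L ∨ ∃ Q ∈ p.2, x ∈ Q}
  refine ((h1.prod h2).image F).subset ?_
  rintro _ ⟨w, rfl⟩
  refine ⟨(K.leftQuotient w, {Q | ∃ u ∈ K, ∃ v, w = u ++ a :: v ∧ Q = L.leftQuotient v}),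
    ⟨⟨w, rfl⟩, ?_⟩, ?_⟩
  · rintro _ ⟨u, -, v, -, rfl⟩
    exact ⟨v, rfl⟩
  · ext x
    rw [Language.mem_leftQuotient]
    constructor
    · rintro (⟨u, hu, v, hv, rfl⟩ | ⟨_, ⟨u, hu, v, rfl, rfl⟩, hx⟩)
      · exact ⟨w ++ u, hu, v, hv, by simp⟩
      · exact ⟨u, hu, v ++ x, hx, by simp⟩
    · rintro ⟨k, hk, l, hl, h⟩
      rcases append_append_eq_append_cons (x := w) (y := x) (z := []) (by simpa using h) with
        ⟨v, rfl, rfl⟩ | ⟨u, v, rfl, rfl, rfl⟩ | ⟨z', h, -⟩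
      · exact Or.inr ⟨_, ⟨k, hk, v, rfl, rfl⟩, by simpa using hl⟩
      · exact Or.inl ⟨u, hk, v, by simpa using hl, rfl⟩
      · simp at h

theorem InUPol.isRegular {A : Type*} {C : Set (Language A)} (hC : ∀ L ∈ C, L.IsRegular)
    {L : Language A} (h : InUPol C L) : L.IsRegular := by
  induction h with
  | base L h => exact hC L h
  | disjUnion K L _ _ _ hK hL => exact hK.add hL
  | concat K a L _ _ _ hK hL => exact isRegular_markedConcat hK hL a

/-- Exponent 1 works for languages recognized by `f`, since `u w u` and `u` have the same value.
Exponents can be enlarged, so the two parts of a union or product can share one. -/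
theorem InUPol.exists_absorbs {A N : Type*} [Monoid N] {f : A → N} {C : Set (Language A)}
    (hC : ∀ L ∈ C, Recognizes f L) {L : Language A} (h : InUPol C L) : ∃ p, Absorbs f L p := by
  induction h with
  | base L h => exact ⟨1, Absorbs.of_saturated (hC L h)⟩
  | disjUnion K L _ _ _ hK hL =>
    obtain ⟨p, hp⟩ := hK
    obtain ⟨q, hq⟩ := hL
    exact ⟨max p q, (hp.mono (le_max_left _ _)).union (hq.mono (le_max_right _ _))⟩
  | concat K a L _ _ hun hK hL =>
    obtain ⟨p, hp⟩ := hK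
    obtain ⟨q, hq⟩ := hL
    exact ⟨_, Absorbs.concat hun (hp.mono (le_max_left p q)) (hq.mono (le_max_right p q))⟩

/-! ### The finite monoid of a finite prevariety -/

theorem mem_of_ext {A : Type*} {C : Set (Language A)} {K L : Language A} (h : L ∈ C)
    (e : ∀ w, w ∈ K ↔ w ∈ L) : K ∈ C := by
  rwa [show K = L from Set.ext e]

/-- The congruence of the words that belong to the same languages of a prevariety. -/
def prevarietyCon {A : Type*} {C : Set (Language A)} (hC : IsPrevariety C) :
    Con (FreeMonoid A) where
  r u v := ∀ L ∈ C, u.toList ∈ L ↔ v.toList ∈ L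
  iseqv := ⟨fun _ _ _ => Iff.rfl, fun h L hL => (h L hL).symm,
    fun h h' L hL => (h L hL).trans (h' L hL)⟩
  mul' := by
    intro u v u' v' h h' L hL
    rw [FreeMonoid.toList_mul, FreeMonoid.toList_mul]
    exact (h _ (hC.rightQuotient_mem L hL u'.toList)).trans
      (h' _ (hC.leftQuotient_mem L hL v.toList))

universe u in
/-- A finite prevariety consists of languages recognized by a morphism onto a finite monoid, and
contains the preimages of the elements of this monoid. -/
theorem exists_monoid_of_isPrevariety {A : Type u} {C : Set (Language A)} (hC : IsPrevariety C)
    (hfin : C.Finite) : ∃ (N : Type u) (_ : Monoid N) (_ : Finite N) (f : A → N),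
      Function.Surjective (val f) ∧ (∀ L ∈ C, Recognizes f L) ∧
        ∀ s, ({w | val f w = s} : Language A) ∈ C := by
  let f : A → (prevarietyCon hC).Quotient := fun a => (prevarietyCon hC).mk' (FreeMonoid.of a)
  have hval : ∀ w, val f w = (prevarietyCon hC).mk' (FreeMonoid.ofList w) := by
    intro w
    induction w with
    | nil => simp
    | cons a w ih => rw [val_cons, ih, FreeMonoid.ofList_cons, map_mul]
  have heq : ∀ u v, val f u = val f v ↔ ∀ L ∈ C, u ∈ L ↔ v ∈ L := by
    intro u v
    rw [hval, hval]
    exact (prevarietyCon hC).eq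
  have hsurj : Function.Surjective (val f) := by
    intro s
    obtain ⟨u, rfl⟩ := (prevarietyCon hC).mk'_surjective s
    exact ⟨u.toList, hval _⟩
  have hfinN : Finite (prevarietyCon hC).Quotient := by
    have := hfin.to_subtype
    refine Finite.of_injective (β := Set C)
      (fun s => {L | Function.surjInv hsurj s ∈ L.1}) ?_
    intro s t h
    rw [← Function.surjInv_eq hsurj s, ← Function.surjInv_eq hsurj t, heq]
    intro L hL
    exact Set.ext_iff.1 h ⟨L, hL⟩
  refine ⟨_, inferInstance, hfinN, f, hsurj, fun L hL u v h => (heq u v).1 h L hL, fun s => ?_⟩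
  obtain ⟨u, rfl⟩ := hsurj s
  -- The fibre of `u` is the intersection of the languages of `C` that contain `u` and the
  -- complements of the others; finiteness of `C` makes this a Boolean combination.
  have hinter : ∀ D : Set (Language A), D.Finite → D ⊆ C →
      ({w | ∀ L ∈ D, w ∈ L ↔ u ∈ L} : Language A) ∈ C := by
    intro D hD
    induction D, hD using Set.Finite.induction_on with
    | empty =>
      intro _
      refine mem_of_ext (hC.univ_mem) fun w => ?_
      simp only [Set.mem_empty_iff_false, false_imp_iff, implies_true]
      rfl
    | @insert L D _ _ ih =>
      intro h
      have h1 := ih (fun K hK => h (Set.mem_insert_of_mem _ hK))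
      have h2 : ({w | w ∈ L ↔ u ∈ L} : Language A) ∈ C := by
        have hL := h (Set.mem_insert L D)
        by_cases hu : u ∈ L
        · refine mem_of_ext (hL) fun w => ?_
          change (w ∈ L ↔ u ∈ L) ↔ w ∈ L
          tauto
        · refine mem_of_ext (hC.compl_mem L hL) fun w => ?_
          change (w ∈ L ↔ u ∈ L) ↔ ¬ w ∈ L
          tauto
      refine mem_of_ext (hC.inter_mem _ h2 _ h1) fun w => ?_
      change (∀ K ∈ insert L D, w ∈ K ↔ u ∈ K) ↔ ((w ∈ L ↔ u ∈ L) ∧ ∀ K ∈ D, w ∈ K ↔ u ∈ K)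
      simp
  refine mem_of_ext (hinter C hfin subset_rfl) fun w => ?_
  exact heq w u

/-! ### The J-order and cuts of words -/

/-- The element `x` lies in the two-sided ideal generated by `s`. -/
def Below {N : Type*} [Monoid N] (x s : N) : Prop := ∃ a b, x = a * s * b

section Below

variable {N : Type*} [Monoid N] {x y s : N}

theorem Below.refl (s : N) : Below s s := ⟨1, 1, by simp⟩

theorem Below.trans (h : Below x y) (h' : Below y s) : Below x s := by
  obtain ⟨a, b, rfl⟩ := h
  obtain ⟨c, d, rfl⟩ := h'
  exact ⟨a * c, d * b, by simp only [mul_assoc]⟩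

theorem Below.mul_left (h : Below x s) (y : N) : Below (y * x) s := by
  obtain ⟨a, b, rfl⟩ := h
  exact ⟨y * a, b, by simp only [mul_assoc]⟩

theorem Below.mul_right (h : Below x s) (y : N) : Below (x * y) s := by
  obtain ⟨a, b, rfl⟩ := h
  exact ⟨a, b * y, by simp only [mul_assoc]⟩

theorem Below.of_one (h : Below 1 s) (x : N) : Below x s := by
  simpa using h.mul_left x

theorem below_mul_left (x y : N) : Below (x * y) y := ⟨x, 1, by simp⟩

theorem below_mul_right (x y : N) : Below (x * y) x := ⟨1, y, by simp⟩

end Below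

/-- A rule `c` selecting, in each word whose value does not generate the unit ideal, one letter by
a condition on the values of the prefix and the suffix around it. -/
structure IsCut {A N : Type*} [Monoid N] (f : A → N) (c : N → A → N → Prop) : Prop where
  unique : ∀ {u v u' v' : List A} {a a' : A}, u ++ a :: v = u' ++ a' :: v' →
    c (val f u) a (val f v) → c (val f u') a' (val f v') → u = u'
  exists_cut : ∀ w : List A, ¬ Below 1 (val f w) →
    ∃ u a v, w = u ++ a :: v ∧ c (val f u) a (val f v)
  nonunit : ∀ {t a v}, c t a v → ¬ Below 1 (t * f a * v)

/-- The cut after the shortest prefix whose value lies in the ideal of the value of the word. -/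
def cutL {A N : Type*} [Monoid N] (f : A → N) (t : N) (a : A) (v : N) : Prop :=
  ¬ Below t (t * f a * v) ∧ Below (t * f a) (t * f a * v)

/-- The cut before the shortest suffix whose value lies in the ideal of the value of the word. -/
def cutR {A N : Type*} [Monoid N] (f : A → N) (t : N) (a : A) (v : N) : Prop :=
  ¬ Below v (t * f a * v) ∧ Below (f a * v) (t * f a * v)

section cuts

variable {A N : Type*} [Monoid N] (f : A → N)

theorem append_cons_cases {A : Type*} {u v u' v' : List A} {a a' : A}
    (h : u ++ a :: v = u' ++ a' :: v') :
    u = u' ∨ (∃ x, u' = u ++ a :: x ∧ v = x ++ a' :: v') ∨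
      ∃ x, u = u' ++ a' :: x ∧ v' = x ++ a :: v := by
  rcases append_append_eq_append_cons (x := u) (y := [a]) (z := v) (by simpa using h) with
    ⟨x, rfl, rfl⟩ | ⟨y₁, y₂, hy, rfl, rfl⟩ | ⟨x, rfl, rfl⟩
  · exact Or.inr (Or.inr ⟨x, rfl, by simp⟩)
  · have : y₁ = [] := by
      rcases y₁ with _ | ⟨b, y₁⟩
      · rfl
      · simp at hy
    exact Or.inl (by simp [this])
  · exact Or.inr (Or.inl ⟨x, by simp, rfl⟩)

/-- Longer prefixes have values in smaller ideals, so a prefix enters the ideal of the whole word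
only once. The entry is at a letter because the empty prefix, of value 1, is outside this ideal. -/
theorem isCut_cutL : IsCut f (cutL f) where
  unique := by
    have aux : ∀ {u v x v' : List A} {a a' : A}, v = x ++ a' :: v' →
        cutL f (val f u) a (val f v) → cutL f (val f (u ++ a :: x)) a' (val f v') → False := by
      rintro u _ x v' a a' rfl h h'
      have := h.2.mul_right (val f x)
      apply h'.1
      simpa [mul_assoc] using this
    intro u v u' v' a a' h h1 h2
    rcases append_cons_cases h with h | ⟨x, rfl, hx⟩ | ⟨x, rfl, hx⟩
    · exact h
    · exact (aux hx h1 h2).elim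
    · exact (aux hx h2 h1).elim
  exists_cut := by
    intro w hw
    have aux : ∀ (s : N) (w x : List A), ¬ Below (val f x) s → Below (val f (x ++ w)) s →
        ∃ u a v, w = u ++ a :: v ∧ ¬ Below (val f (x ++ u)) s ∧
          Below (val f (x ++ u) * f a) s := by
      intro s w
      induction w with
      | nil => intro x h h'; simp at h'; exact (h h').elim
      | cons b w ih =>
        intro x h h'
        by_cases hb : Below (val f (x ++ [b])) s
        · exact ⟨[], b, w, rfl, by simpa using h, by simpa using hb⟩
        · obtain ⟨u, a, v, rfl, h1, h2⟩ := ih (x ++ [b]) hb (by simpa using h')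
          exact ⟨b :: u, a, v, rfl, by simpa using h1, by simpa using h2⟩
    obtain ⟨u, a, v, rfl, h1, h2⟩ := aux (val f w) w [] (by simpa using hw)
      (by simpa using Below.refl _)
    refine ⟨u, a, v, rfl, ?_⟩
    simpa [cutL, mul_assoc] using And.intro h1 h2
  nonunit := fun h h' => h.1 (h'.of_one _)

theorem isCut_cutR : IsCut f (cutR f) where
  unique := by
    have aux : ∀ {u v x v' : List A} {a a' : A}, v = x ++ a' :: v' →
        cutR f (val f u) a (val f v) → cutR f (val f (u ++ a :: x)) a' (val f v') → False := by
      rintro u _ x v' a a' rfl h h'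
      have := h'.2.mul_left (val f x)
      apply h.1
      simpa [mul_assoc] using this
    intro u v u' v' a a' h h1 h2
    rcases append_cons_cases h with h | ⟨x, rfl, hx⟩ | ⟨x, rfl, hx⟩
    · exact h
    · exact (aux hx h1 h2).elim
    · exact (aux hx h2 h1).elim
  exists_cut := by
    intro w hw
    have aux : ∀ (s : N) (w : List A), ¬ Below 1 s → Below (val f w) s →
        ∃ u a v, w = u ++ a :: v ∧ ¬ Below (val f v) s ∧ Below (f a * val f v) s := by
      intro s w h
      induction w with
      | nil => intro h'; simp at h'; exact (h h').elim
      | cons b w ih =>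
        intro h'
        by_cases hb : Below (val f w) s
        · obtain ⟨u, a, v, rfl, h1, h2⟩ := ih hb
          exact ⟨b :: u, a, v, rfl, h1, h2⟩
        · exact ⟨[], b, w, rfl, hb, by simpa using h'⟩
    obtain ⟨u, a, v, rfl, h1, h2⟩ := aux (val f w) w hw (Below.refl _)
    refine ⟨u, a, v, rfl, ?_⟩
    simpa [cutR, mul_assoc] using And.intro h1 h2
  nonunit := fun h h' => h.1 (h'.of_one _)

end cuts

/-! ### Partitions obtained by alternating cuts -/

section cutRefine

variable {A N : Type*} [Monoid N] (f : A → N)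

/-- The family of the products of two members of `P` at the letter selected by the rule `c`. The
members that `c` does not cut are kept. -/
def cutRefine (c : N → A → N → Prop) (P : Set (N × Language A)) : Set (N × Language A) :=
  {q | (q ∈ P ∧ Below 1 q.1) ∨ ∃ r ∈ P, ∃ a, ∃ r' ∈ P, c r.1 a r'.1 ∧
    q = (r.1 * f a * r'.1, markedConcat r.2 a r'.2)}

/-- The sequence of partitions of the set of all words, starting with the fibres of the morphism
and refined by alternating cuts from the left and from the right. -/
def classes : ℕ → Set (N × Language A)
  | 0 => Set.range fun s => (s, {w | val f w = s})
  | k + 1 => cutRefine f (cutL f) (cutRefine f (cutR f) (classes k))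

/-- A finite partition of the set of all words into languages of the unambiguous polynomial closure
of `C`, each included in the fibre of the value that indexes it. -/
structure IsUPolPartition (C : Set (Language A)) (P : Set (N × Language A)) : Prop where
  fibre : ∀ {q}, q ∈ P → ∀ {w}, w ∈ q.2 → val f w = q.1
  cover : ∀ w, ∃ q ∈ P, w ∈ q.2
  disjoint : ∀ {q q'}, q ∈ P → q' ∈ P → ∀ {w}, w ∈ q.2 → w ∈ q'.2 → q = q'
  finite : P.Finite
  upol : ∀ {q}, q ∈ P → InUPol C q.2

variable {f} {C : Set (Language A)}

/-- Members have constant values, so each product consists of words cut exactly at its marked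
letter. Uniqueness of the cut then yields both unambiguity and disjointness; `nonunit` separates the
products from the members that are kept. -/
theorem IsUPolPartition.cutRefine [Finite A] {c : N → A → N → Prop} (hc : IsCut f c)
    {P : Set (N × Language A)} (hP : IsUPolPartition f C P) :
    IsUPolPartition f C (cutRefine f c P) := by
  have hfib : ∀ {q}, q ∈ UPolCov.cutRefine f c P → ∀ {w}, w ∈ q.2 → val f w = q.1 := by
    rintro _ (⟨h, -⟩ | ⟨r, hr, a, r', hr', h, rfl⟩) w hw
    · exact hP.fibre h hw
    · obtain ⟨u, hu, v, hv, rfl⟩ := hw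
      simp [hP.fibre hr hu, hP.fibre hr' hv, mul_assoc]
  refine ⟨hfib, ?_, ?_, ?_, ?_⟩
  · intro w
    by_cases hw : Below 1 (val f w)
    · obtain ⟨q, hq, hwq⟩ := hP.cover w
      exact ⟨q, Or.inl ⟨hq, by rwa [← hP.fibre hq hwq]⟩, hwq⟩
    · obtain ⟨u, a, v, rfl, h⟩ := hc.exists_cut w hw
      obtain ⟨r, hr, hu⟩ := hP.cover u
      obtain ⟨r', hr', hv⟩ := hP.cover v
      rw [hP.fibre hr hu, hP.fibre hr' hv] at h
      exact ⟨_, Or.inr ⟨r, hr, a, r', hr', h, rfl⟩, u, hu, v, hv, rfl⟩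
  · intro q q' hq hq' w hw hw'
    have hqq : q.1 = q'.1 := by rw [← hfib hq hw, hfib hq' hw']
    rcases hq with ⟨hq, h1⟩ | ⟨r, hr, a, s, hs, h, rfl⟩ <;>
      rcases hq' with ⟨hq', h1'⟩ | ⟨r', hr', a', s', hs', h', rfl⟩
    · exact hP.disjoint hq hq' hw hw'
    · rw [hqq] at h1
      exact (hc.nonunit h' h1).elim
    · rw [← hqq] at h1'
      exact (hc.nonunit h h1').elim
    · obtain ⟨u, hu, v, hv, rfl⟩ := hw
      obtain ⟨u', hu', v', hv', hw⟩ := hw'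
      rw [← hP.fibre hr hu, ← hP.fibre hs hv] at h
      rw [← hP.fibre hr' hu', ← hP.fibre hs' hv'] at h'
      obtain rfl := hc.unique hw h h'
      simp only [List.append_cancel_left_eq, List.cons.injEq] at hw
      obtain ⟨rfl, rfl⟩ := hw
      rw [hP.disjoint hr hr' hu hu', hP.disjoint hs hs' hv hv']
  · refine ((hP.finite.prod (Set.finite_univ.prod hP.finite)).image
      (fun x : (N × Language A) × A × (N × Language A) =>
        (x.1.1 * f x.2.1 * x.2.2.1, markedConcat x.1.2 x.2.1 x.2.2.2))).union hP.finite |>.subset ?_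
    rintro _ (⟨h, -⟩ | ⟨r, hr, a, r', hr', h, rfl⟩)
    · exact Or.inr h
    · exact Or.inl ⟨(r, a, r'), ⟨hr, Set.mem_univ _, hr'⟩, rfl⟩
  · rintro _ (⟨h, -⟩ | ⟨r, hr, a, r', hr', h, rfl⟩)
    · exact hP.upol h
    · refine InUPol.concat _ _ _ (hP.upol hr) (hP.upol hr') ?_
      intro u hu u' hu' v hv v' hv' huv
      obtain rfl := hc.unique huv (by rwa [hP.fibre hr hu, hP.fibre hr' hv])
        (by rwa [hP.fibre hr hu', hP.fibre hr' hv'])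
      simpa using huv

theorem isUPolPartition_classes [Finite A] [Finite N]
    (hC : ∀ s, ({w | val f w = s} : Language A) ∈ C) (k : ℕ) :
    IsUPolPartition f C (classes f k) := by
  induction k with
  | zero =>
    refine ⟨?_, ?_, ?_, ?_, ?_⟩
    · rintro _ ⟨s, rfl⟩ w hw
      exact hw
    · exact fun w => ⟨_, ⟨val f w, rfl⟩, rfl⟩
    · rintro _ _ ⟨s, rfl⟩ ⟨s', rfl⟩ w (rfl : _ = _) (rfl : _ = _)
      rfl
    · exact Set.finite_range _
    · rintro _ ⟨s, rfl⟩
      exact InUPol.base _ (hC s)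
  | succ k ih => exact (ih.cutRefine (isCut_cutR f)).cutRefine (isCut_cutL f)

/-- A finite partition into languages of `UPol C` yields the unions of its members. -/
theorem IsUPolPartition.inUPol_biUnion {P Q : Set (N × Language A)} (hP : IsUPolPartition f C P)
    (hC : ⊥ ∈ C) (hQ : Q ⊆ P) : InUPol C {w | ∃ q ∈ Q, w ∈ q.2} := by
  have hfin := hP.finite.subset hQ
  induction Q, hfin using Set.Finite.induction_on with
  | empty => exact InUPol.base _ (mem_of_ext hC fun w => by
      simp only [Set.mem_empty_iff_false, false_and, exists_false]
      rfl)
  | @insert q Q hq _ ih =>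
    have h := InUPol.disjUnion _ _ (hP.upol (hQ (Set.mem_insert _ _)))
      (ih fun r hr => hQ (Set.mem_insert_of_mem _ hr)) ?_
    · have h2 : q.2 ⊔ {w | ∃ r ∈ Q, w ∈ r.2} = {w | ∃ r ∈ insert q Q, w ∈ r.2} := by
        apply Set.ext
        intro w
        change w ∈ q.2 ∨ (∃ r ∈ Q, w ∈ r.2) ↔ ∃ r ∈ insert q Q, w ∈ r.2
        simp
      rwa [h2] at h
    · apply Set.eq_empty_of_forall_notMem
      rintro w ⟨h1, r, hr, h2⟩
      obtain rfl := hP.disjoint (hQ (Set.mem_insert _ _)) (hQ (Set.mem_insert_of_mem _ hr)) h1 h2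
      exact hq hr

end cutRefine

/-! ### Idempotent powers and stability in finite monoids -/

theorem exists_pow_isIdempotentElem {N : Type*} [Monoid N] [Finite N] (x : N) :
    ∃ n, IsIdempotentElem (x ^ (n + 1)) := by
  obtain ⟨i, j, hij, h⟩ := Finite.exists_ne_map_eq_of_infinite fun n : ℕ => x ^ n
  wlog hlt : i < j generalizing i j
  · exact this j i hij.symm h.symm (by omega)
  obtain ⟨d, rfl⟩ := Nat.exists_eq_add_of_lt hlt
  have h1 : ∀ k, i ≤ k → x ^ (k + (d + 1)) = x ^ k := by
    intro k hk
    obtain ⟨c, rfl⟩ := Nat.exists_eq_add_of_le hk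
    rw [show i + c + (d + 1) = (i + d + 1) + c by omega, pow_add, ← h, ← pow_add]
  have h2 : ∀ m k, i ≤ k → x ^ (k + m * (d + 1)) = x ^ k := by
    intro m
    induction m with
    | zero => simp
    | succ m ih =>
      intro k hk
      rw [Nat.succ_mul, ← Nat.add_assoc, h1 _ (by omega), ih k hk]
  -- The exponent is `(i + 1) * (d + 1)`: a multiple of the period `d + 1` that exceeds the
  -- preperiod `i`.
  refine ⟨i + d + i * d, ?_⟩
  have h3 : i + d + i * d + 1 = (i + 1) * (d + 1) := by ring
  rw [h3]
  change x ^ _ * x ^ _ = _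
  rw [← pow_add]
  exact h2 _ _ (by nlinarith)

section Green

variable {N : Type*} [Monoid N] [Finite N]

/-- Stability of finite monoids. Iterating `y = a y (x b)` gives `y = a ^ n y (x b) ^ n`; when the
power of `x b` is idempotent, it fixes `y` on the right. -/
theorem exists_mul_right_of_below {y x : N} (h : Below y (y * x)) : ∃ v, y * x * v = y := by
  obtain ⟨a, b, hab⟩ := h
  have h1 : ∀ n, y = a ^ n * y * (x * b) ^ n := by
    intro n
    induction n with
    | zero => simp
    | succ n ih =>
      have : y = a * y * (x * b) := by simpa only [mul_assoc] using hab
      calc y = a ^ n * y * (x * b) ^ n := ih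
        _ = a ^ n * (a * y * (x * b)) * (x * b) ^ n := by rw [← this]
        _ = _ := by rw [pow_succ, pow_succ']; simp only [mul_assoc]
  obtain ⟨n, hn⟩ := exists_pow_isIdempotentElem (x * b)
  refine ⟨b * (x * b) ^ n, ?_⟩
  have h2 : y * (x * b) ^ (n + 1) = y := by
    rw [h1 (n + 1), mul_assoc _ ((x * b) ^ (n + 1)), hn.eq]
  rw [pow_succ'] at h2
  simpa only [mul_assoc] using h2

theorem exists_mul_left_of_below {y x : N} (h : Below y (x * y)) : ∃ v, v * (x * y) = y := by
  obtain ⟨a, b, hab⟩ := h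
  have h1 : ∀ n, y = (a * x) ^ n * y * b ^ n := by
    intro n
    induction n with
    | zero => simp
    | succ n ih =>
      have : y = (a * x) * y * b := by simpa only [mul_assoc] using hab
      calc y = (a * x) ^ n * y * b ^ n := ih
        _ = (a * x) ^ n * ((a * x) * y * b) * b ^ n := by rw [← this]
        _ = _ := by rw [pow_succ, pow_succ']; simp only [mul_assoc]
  obtain ⟨n, hn⟩ := exists_pow_isIdempotentElem (a * x)
  refine ⟨(a * x) ^ n * a, ?_⟩
  have h2 : (a * x) ^ (n + 1) * y = y := by
    rw [h1 (n + 1), ← mul_assoc, ← mul_assoc, hn.eq]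
  rw [pow_succ] at h2
  simpa only [mul_assoc] using h2

end Green

theorem below_flatten {A N : Type*} [Monoid N] {f : A → N} {s : N} {l : List (List A)} (hl : l ≠ [])
    (h : ∀ u ∈ l, Below (val f u) s) : Below (val f l.flatten) s := by
  rcases l with _ | ⟨u, l⟩
  · exact (hl rfl).elim
  · rw [List.flatten_cons, val_append]
    exact (h u List.mem_cons_self).mul_right _

theorem val_prod {A M N : Type*} [Monoid M] [Monoid N] (g : A → M) (f : A → N) (w : List A) : val (fun a => (g a, f a)) w = (val g w, val f w) := by
  induction w with
  | nil => rfl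
  | cons a w ih => rw [val_cons, val_cons, val_cons, ih]; rfl

/-! ### Exchanging factors inside a J-class -/

section Saturation

variable {A N : Type*} [Monoid N] [Finite N] {f : A → N} {L : Language A} {p : ℕ}

/-- Between high powers of two words whose idempotent values lie in one `J`-class, a factor that
does not leave this class matters only by its value. -/
theorem Absorbs.middle (hf : Function.Surjective (val f)) (h : Absorbs f L p) {g k z z' : List A}
    {s : N} (hg : IsIdempotentElem (val f g)) (hk : IsIdempotentElem (val f k))
    (hgs : Below (val f g) s) (hks : Below (val f k) s) (hz : val f z = val f z')
    (hs : Below s (val f g * val f z * val f k)) :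
    SynEq L (wpow g p ++ (z ++ wpow k p)) (wpow g p ++ (z' ++ wpow k p)) := by
  -- All of `g`, `k` and `g z k` have values in the J-class of `s`, so by stability the product can
  -- be undone on the right to recover `g`, and on the left to recover `k`.
  obtain ⟨v, hv⟩ := exists_mul_right_of_below (y := val f g) (x := val f z * val f k)
    (by rw [← mul_assoc]; exact hgs.trans hs)
  obtain ⟨v', hv'⟩ := exists_mul_left_of_below (y := val f k) (x := val f g * val f z)
    (hks.trans hs)
  -- `V` leads back from `k` to `g`: the loop at `g` through `z'` has the value of `g`, and the loop
  -- at `k` through `z` has the value of `k`.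
  obtain ⟨V, hV⟩ := hf (val f k * v * val f g)
  have hw1 : val f (g ++ (z' ++ (wpow k p ++ V))) = val f g := by
    simp only [val_append, val_wpow, hV, ← hz]
    calc val f g * (val f z * (val f k ^ p * (val f k * v * val f g)))
        = val f g * (val f z * (val f k ^ p * val f k * v * val f g)) := by
          simp only [mul_assoc]
      _ = val f g * (val f z * val f k) * v * val f g := by
          rw [pow_mul_idem hk]; simp only [mul_assoc]
      _ = val f g := by rw [hv, hg.eq]
  have hw2 : val f (V ++ (wpow g p ++ (z ++ k))) = val f k := by
    simp only [val_append, val_wpow, hV]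
    calc val f k * v * val f g * (val f g ^ p * (val f z * val f k))
        = val f k * v * (val f g * val f g ^ p) * val f z * val f k := by simp only [mul_assoc]
      _ = val f k * v * val f g * val f z * val f k := by rw [mul_pow_idem hg]
      _ = v' * (val f g * val f z * val f k) * v * val f g * val f z * val f k := by rw [hv']
      _ = v' * (val f g * (val f z * val f k) * v * val f g) * val f z * val f k := by
          simp only [mul_assoc]
      _ = val f k := by rw [hv, hg.eq, mul_assoc v', mul_assoc v', hv']
  have e1 : SynEq L (wpow g p ++ g) (wpow g p) := by
    have := h.wpow_synEq hg (Nat.le_succ p)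
    rwa [Nat.succ_eq_add_one, wpow_add, wpow_one] at this
  have e2 : SynEq L (wpow k p) (k ++ wpow k p) := (h.wpow_synEq hk (Nat.le_succ p)).symm
  -- Insert the loop through `z'` after `g ^ p`, then delete the loop through `z` before `k ^ p`.
  have s1 := (h g _ hg hw1).symm.append_right (z ++ wpow k p)
  have s2 := e1.append (((((e2.append_left z).append_left (wpow g p)).append_left V).append_left
    (wpow k p)).append_left z')
  have s3 := ((h k _ hk hw2).append_left z').append_left (wpow g p)
  simp only [List.append_assoc] at s1 s2 s3
  exact (s1.trans s2).trans s3

theorem list_split {α : Type*} (l : List α) {i j : ℕ} (hij : i < j) (hj : j ≤ l.length) :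
    ∃ l₁ l₂ l₃, l₂ ≠ [] ∧ l = l₁ ++ (l₂ ++ l₃) ∧ l.take i = l₁ ∧ l.take j = l₁ ++ l₂ ∧
      l.drop i = l₂ ++ l₃ ∧ l.drop j = l₃ := by
  have h1 : l.take j = l.take i ++ (l.take j).drop i := by
    conv_lhs => rw [← List.take_append_drop i (l.take j), List.take_take, min_eq_left hij.le]
  have h2 : l = l.take i ++ ((l.take j).drop i ++ l.drop j) := by
    rw [← List.append_assoc, ← h1, List.take_append_drop]
  refine ⟨l.take i, (l.take j).drop i, l.drop j, ?_, h2, rfl, h1, ?_, rfl⟩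
  · intro h
    have := congrArg List.length h
    simp at this
    omega
  · have h3 := List.take_append_drop i l
    rw [h2] at h3
    conv_lhs at h3 => rw [← h2]
    exact List.append_cancel_left h3

theorem exists_lt_eq_of_card {α : Type*} [Finite α] (F : ℕ → α) {n : ℕ} (hn : Nat.card α ≤ n) :
    ∃ i j, i < j ∧ j ≤ n ∧ F i = F j := by
  have := Fintype.ofFinite α
  obtain ⟨i, j, hij, h⟩ := Fintype.exists_ne_map_eq_of_card_lt (fun i : Fin (n + 1) => F i)
    (by rw [← Nat.card_eq_fintype_card, Fintype.card_fin]; omega)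
  rcases lt_or_gt_of_ne hij with h' | h'
  · exact ⟨i, j, h', by omega, h⟩
  · exact ⟨j, i, h', by omega, h.symm⟩

variable {M : Type*} [Monoid M] [Finite M] {g : A → M}

/-- Pigeonhole on the pairs of values of the prefixes of `l`. The block between two equal pairs is
nonempty, which keeps its value in the ideal of `s`. -/
theorem pump_left {s : N} {l : List (List A)} (hl : Nat.card (M × N) ≤ l.length)
    (h : ∀ u ∈ l, Below (val f u) s) : ∃ x y z, l.flatten = x ++ (y ++ z) ∧ Below (val f y) s ∧
      val g (x ++ y) = val g x ∧ val f (x ++ y) = val f x := by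
  obtain ⟨i, j, hij, hj, heq⟩ := exists_lt_eq_of_card
    (fun i => (val g (l.take i).flatten, val f (l.take i).flatten)) hl
  obtain ⟨l₁, l₂, l₃, hne, hl', h1, h2, -, -⟩ := list_split l hij hj
  simp only [h1, h2, Prod.mk.injEq, List.flatten_append] at heq
  refine ⟨l₁.flatten, l₂.flatten, l₃.flatten, by rw [hl']; simp, below_flatten hne ?_,
    heq.1.symm, heq.2.symm⟩
  intro u hu
  exact h u (by rw [hl']; simp [hu])

theorem pump_right {s : N} {l : List (List A)} (hl : Nat.card (M × N) ≤ l.length)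
    (h : ∀ u ∈ l, Below (val f u) s) : ∃ x y z, l.flatten = x ++ (y ++ z) ∧ Below (val f y) s ∧
      val g (y ++ z) = val g z ∧ val f (y ++ z) = val f z := by
  obtain ⟨i, j, hij, hj, heq⟩ := exists_lt_eq_of_card
    (fun i => (val g (l.drop i).flatten, val f (l.drop i).flatten)) hl
  obtain ⟨l₁, l₂, l₃, hne, hl', -, -, h1, h2⟩ := list_split l hij hj
  simp only [h1, h2, Prod.mk.injEq, List.flatten_append] at heq
  refine ⟨l₁.flatten, l₂.flatten, l₃.flatten, by rw [hl']; simp, below_flatten hne ?_,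
    heq.1, heq.2⟩
  intro u hu
  exact h u (by rw [hl']; simp [hu])

theorem val_append_wpow {M : Type*} [Monoid M] {g : A → M} {x y : List A}
    (h : val g (x ++ y) = val g x) (n : ℕ) : val g (x ++ wpow y n) = val g x := by
  induction n with
  | zero => simp [wpow]
  | succ n ih => rw [wpow_succ, ← List.append_assoc, val_append, h, ← val_append, ih]

theorem val_wpow_append {M : Type*} [Monoid M] {g : A → M} {y z : List A}
    (h : val g (y ++ z) = val g z) (n : ℕ) : val g (wpow y n ++ z) = val g z := by
  induction n with
  | zero => simp [wpow]
  | succ n ih => rw [wpow_succ, List.append_assoc, val_append, ih, ← val_append, h]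

/-- Between long products of words of a `J`-class, a factor that does not leave this class matters
only by its value. -/
theorem Absorbs.middle_of_chains (hf : Function.Surjective (val f)) (h : Absorbs f L p)
    (hg : Recognizes g L) {s : N} {l r : List (List A)} (hl : Nat.card (M × N) ≤ l.length)
    (hr : Nat.card (M × N) ≤ r.length) (hls : ∀ u ∈ l, Below (val f u) s)
    (hrs : ∀ u ∈ r, Below (val f u) s) {m m' : List A} (hm : val f m = val f m')
    (hs : Below s (val f (l.flatten ++ (m ++ r.flatten)))) :
    SynEq L (l.flatten ++ (m ++ r.flatten)) (l.flatten ++ (m' ++ r.flatten)) := by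
  obtain ⟨x, y, z, hx, hys, hxyg, hxyf⟩ := pump_left (g := g) hl hls
  obtain ⟨x', y', z', hx', hys', hyzg, hyzf⟩ := pump_right (g := g) hr hrs
  obtain ⟨n, hn⟩ := exists_pow_isIdempotentElem (val f y)
  obtain ⟨n', hn'⟩ := exists_pow_isIdempotentElem (val f y')
  rw [hx, hx'] at hs ⊢
  -- Pumping the repeated blocks to idempotent powers changes no value under `g`, hence nothing up
  -- to equivalence. This creates the powers `G ^ p` and `H ^ p` that `Absorbs.middle` needs around
  -- the exchanged factor.
  set G := wpow y (n + 1) with hG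
  set H := wpow y' (n' + 1) with hH
  have e1 : SynEq L (x ++ wpow G p) x :=
    hg.synEq (val_append_wpow (val_append_wpow hxyg (n + 1)) p)
  have e2 : SynEq L (wpow H p ++ z') (y' ++ z') := by
    refine hg.synEq ?_
    rw [val_wpow_append (val_wpow_append hyzg (n' + 1)) p, hyzg]
  have key := h.middle hf (g := G) (k := H) (z := y ++ (z ++ (m ++ x')))
    (z' := y ++ (z ++ (m' ++ x'))) (s := s) (by rwa [hG, val_wpow]) (by rwa [hH, val_wpow])
    (by rw [hG, wpow_succ, val_append]; exact hys.mul_right _)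
    (by rw [hH, wpow_succ, val_append]; exact hys'.mul_right _) (by simp [hm]) ?_
  · have e3 : ∀ m, SynEq L (x ++ (y ++ z) ++ (m ++ (x' ++ (y' ++ z'))))
        (x ++ ((wpow G p ++ ((y ++ (z ++ (m ++ x'))) ++ wpow H p)) ++ z')) := by
      intro m
      have := e1.symm.append ((e2.symm.append_left (y ++ (z ++ (m ++ x')))))
      simpa only [List.append_assoc] using this
    exact ((e3 m).trans ((key.append_right z').append_left x)).trans (e3 m').symm
  · have hv1 : val f x = val f x * val f G := by
      rw [← val_append, val_append_wpow hxyf]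
    have hv2 : val f y' * val f z' = val f H * val f z' := by
      rw [← val_append, ← val_append, val_wpow_append hyzf, hyzf]
    have hv : val f (x ++ (y ++ z) ++ (m ++ (x' ++ (y' ++ z')))) =
        val f x * (val f G * val f (y ++ (z ++ (m ++ x'))) * val f H) * val f z' := by
      calc val f (x ++ (y ++ z) ++ (m ++ (x' ++ (y' ++ z'))))
          = val f x * val f (y ++ (z ++ (m ++ x'))) * (val f y' * val f z') := by
            simp only [val_append, mul_assoc]
        _ = (val f x * val f G) * val f (y ++ (z ++ (m ++ x'))) * (val f H * val f z') := by
            rw [← hv1, ← hv2]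
        _ = _ := by simp only [mul_assoc]
    rw [hv] at hs
    exact hs.trans ((below_mul_right _ _).trans (below_mul_left _ _))

end Saturation

/-! ### Deep classes are pure; the covering criterion -/

section Purity

variable {A N M : Type*} [Finite A] [Monoid N] [Finite N] [Monoid M] [Finite M] {f : A → N}
  {g : A → M} {L : Language A} {p : ℕ}

/-- All words of `X` are syntactically equivalent with respect to `L`. -/
def Pure (L X : Language A) : Prop := ∀ w ∈ X, ∀ w' ∈ X, SynEq L w w'

theorem isUPolPartition_univ (f : A → N) (k : ℕ) :
    IsUPolPartition f Set.univ (classes f k) :=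
  isUPolPartition_classes (fun _ => Set.mem_univ _) k

theorem fibre_classes {k : ℕ} {q : N × Language A} (hq : q ∈ classes f k) {w : List A}
    (hw : w ∈ q.2) : val f w = q.1 :=
  (isUPolPartition_univ f k).fibre hq hw

theorem fibre_cutRefine_classes {k : ℕ} {q : N × Language A}
    (hq : q ∈ cutRefine f (cutR f) (classes f k)) {w : List A} (hw : w ∈ q.2) :
    val f w = q.1 :=
  ((isUPolPartition_univ f k).cutRefine (isCut_cutR f)).fibre hq hw

/-- Words of a class of depth `K + n` are equivalent, or they are equivalent to words that agree up
to a middle factor preceded and followed by `n` factors from the `J`-class. -/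
theorem classes_unfold {s : N} (hs : ¬ Below 1 s) {K : ℕ}
    (hK : ∀ k, K ≤ k → ∀ q : N × Language A, ¬ Below q.1 s → Below s q.1 →
      (q ∈ classes f k → Pure L q.2) ∧ (q ∈ cutRefine f (cutR f) (classes f k) → Pure L q.2))
    (n : ℕ) {q : N × Language A} (hq : q ∈ classes f (K + n)) (h1 : Below q.1 s)
    (h2 : Below s q.1) {w w' : List A} (hw : w ∈ q.2) (hw' : w' ∈ q.2) :
    SynEq L w w' ∨ ∃ (l r : List (List A)) (m m' : List A), l.length = n ∧ r.length = n ∧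
      (∀ u ∈ l, Below (val f u) s) ∧ (∀ u ∈ r, Below (val f u) s) ∧ val f m = val f m' ∧
      w = l.flatten ++ (m ++ r.flatten) ∧ SynEq L w' (l.flatten ++ (m' ++ r.flatten)) := by
  induction n generalizing q w w' with
  | zero =>
    refine Or.inr ⟨[], [], w, w', rfl, rfl, by simp, by simp, ?_, by simp, ?_⟩
    · rw [fibre_classes hq hw, fibre_classes hq hw']
    · simpa using SynEq.refl L w'
  | succ n ih =>
    obtain ⟨-, hq⟩ | ⟨⟨t, X⟩, hX, a, ⟨v, Y⟩, hY, hc, rfl⟩ := hq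
    · exact (hs (hq.trans h1)).elim
    simp only at h1 h2 hc hw hw'
    obtain ⟨x, hx, y, hy, rfl⟩ := hw
    obtain ⟨x', hx', y', hy', rfl⟩ := hw'
    -- The prefix before a left cut is strictly J-above `s`, so its class is already pure by `hK`,
    -- while adding the letter `a` enters the J-class of `s`.
    have hxx : SynEq L x x' := (hK (K + n) (by omega) (t, X) (fun h => hc.1 (h.trans h2))
      (h2.trans (by rw [mul_assoc]; exact below_mul_right _ _))).2 hX x hx x' hx'
    have hxa : Below (val f (x ++ [a])) s := by
      have := hc.2.trans h1
      rwa [val_append, fibre_cutRefine_classes hX hx, val_cons, val_nil, mul_one]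
    have hsv : Below s v := h2.trans (below_mul_left _ _)
    -- If the suffix is still in the J-class of `s`, its right cut peels off a pure factor at the
    -- other end, and the induction continues with the middle `z` when that is in the J-class too.
    -- Otherwise everything that remains is pure.
    by_cases hvs : Below v s
    · obtain ⟨-, hY⟩ | ⟨⟨z, Z⟩, hZ, b, ⟨t', X'⟩, hX', hc', h⟩ := hY
      · exact (hs (hY.trans hvs)).elim
      simp only [Prod.mk.injEq] at h
      obtain ⟨rfl, rfl⟩ := h
      simp only at hc'
      obtain ⟨z₁, hz, x₁, hx₁, rfl⟩ := hy
      obtain ⟨z₁', hz', x₁', hx₁', rfl⟩ := hy'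
      have hxx₁ : SynEq L x₁ x₁' := (hK (K + n) (by omega) (t', X')
        (fun h => hc'.1 (h.trans hsv)) (hsv.trans (below_mul_left _ _))).1 hX' x₁ hx₁ x₁' hx₁'
      have hbx : Below (val f (b :: x₁)) s := by
        have := hc'.2.trans hvs
        rwa [val_cons, fibre_classes hX' hx₁]
      have hsz : Below s z := hsv.trans (by rw [mul_assoc]; exact below_mul_right _ _)
      have happ : ∀ {c c'}, SynEq L c c' →
          SynEq L (x ++ a :: (c ++ b :: x₁)) (x' ++ a :: (c' ++ b :: x₁')) := fun h => by
        have := hxx.append ((h.append (hxx₁.append_left [b])).append_left [a])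
        simpa using this
      by_cases hzs : Below z s
      · obtain h | ⟨l, r, m, m', hl, hr, hls, hrs, hm, rfl, h⟩ := ih hZ hzs hsz hz hz'
        · exact Or.inl (happ h)
        · refine Or.inr ⟨(x ++ [a]) :: l, r ++ [b :: x₁], m, m', by simp [hl], by simp [hr], ?_, ?_,
            hm, by simp, ?_⟩
          · intro u hu
            rcases List.mem_cons.1 hu with rfl | hu
            exacts [hxa, hls u hu]
          · intro u hu
            rcases List.mem_append.1 hu with hu | hu
            · exact hrs u hu
            · rw [List.mem_singleton.1 hu]
              exact hbx
          · have := (happ h.symm).symm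
            simpa using this
      · exact Or.inl (happ ((hK (K + n) (by omega) (z, Z) hzs hsz).1 hZ z₁ hz z₁' hz'))
    · have := hxx.append (((hK (K + n) (by omega) (v, Y) hvs hsv).2 hY y hy y' hy').append_left [a])
      exact Or.inl (by simpa using this)

/-- All classes of large enough depth are contained in classes of the syntactic congruence. -/
theorem Absorbs.exists_pure (hf : Function.Surjective (val f)) (h : Absorbs f L p)
    (hg : Recognizes g L) : ∃ K, ∀ k, K ≤ k → ∀ q ∈ classes f k, Pure L q.2 := by
  -- Induction on the number of elements J-above the value: values strictly above it have fewer.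
  have main : ∀ n, ∃ K, ∀ k, K ≤ k → ∀ q : N × Language A, {x | Below q.1 x}.ncard ≤ n →
      (q ∈ classes f k → Pure L q.2) ∧ (q ∈ cutRefine f (cutR f) (classes f k) → Pure L q.2) := by
    intro n
    induction n with
    | zero =>
      refine ⟨0, fun k _ q hq => ?_⟩
      have := (Set.ncard_pos (s := {x | Below q.1 x}) (Set.toFinite _)).2 ⟨q.1, Below.refl _⟩
      omega
    | succ n ih =>
      obtain ⟨K, hK⟩ := ih
      -- Each unfolding adds one factor to both chains, and the pigeonhole in
      -- `Absorbs.middle_of_chains` needs `Nat.card (M × N)` of them.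
      have first : ∀ k, K + Nat.card (M × N) ≤ k → ∀ q : N × Language A,
          {x | Below q.1 x}.ncard ≤ n + 1 → q ∈ classes f k → Pure L q.2 := by
        intro k hk q hqn hq w hw w' hw'
        obtain ⟨c, rfl⟩ : ∃ c, k = K + c := ⟨k - K, by omega⟩
        by_cases h1 : Below 1 q.1
        -- Words of unit value are never cut, but the empty word lies in their J-class, so chains of
        -- empty words serve.
        · have hrep : ∀ u ∈ List.replicate (Nat.card (M × N)) ([] : List A), Below (val f u) q.1 := by
            intro u hu
            rw [List.eq_of_mem_replicate hu]
            exact h1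
          have hfl : (List.replicate (Nat.card (M × N)) ([] : List A)).flatten = [] := by simp
          have := h.middle_of_chains hf hg (s := q.1) (by simp) (by simp) hrep hrep
            (m := w) (m' := w') (by rw [fibre_classes hq hw, fibre_classes hq hw'])
            (by rw [hfl, List.nil_append, List.append_nil, fibre_classes hq hw]; exact Below.refl _)
          simpa only [hfl, List.nil_append, List.append_nil] using this
        · have hK' : ∀ k, K ≤ k → ∀ r : N × Language A, ¬ Below r.1 q.1 → Below q.1 r.1 →
              (r ∈ classes f k → Pure L r.2) ∧
                (r ∈ cutRefine f (cutR f) (classes f k) → Pure L r.2) := by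
            intro k hk r hr1 hr2
            refine hK k hk r ?_
            have : {x | Below r.1 x}.ncard < {x | Below q.1 x}.ncard := by
              refine Set.ncard_lt_ncard ⟨fun x hx => hr2.trans hx, fun hsub => ?_⟩ (Set.toFinite _)
              exact hr1 (hsub (Below.refl q.1))
            omega
          obtain h2 | ⟨l, r, m, m', hl, hr, hls, hrs, hm, rfl, h3⟩ :=
            classes_unfold h1 hK' c hq (Below.refl _) (Below.refl _) hw hw'
          · exact h2
          · refine SynEq.trans ?_ h3.symm
            refine h.middle_of_chains hf hg (by omega) (by omega) hls hrs hm ?_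
            rw [fibre_classes hq hw]
            exact Below.refl _
      refine ⟨K + Nat.card (M × N), fun k hk q hqn => ⟨first k hk q hqn, ?_⟩⟩
      -- The factors of a half-refined class are J-above the product, so `first` applies to both at
      -- the same depth.
      rintro (⟨hq, -⟩ | ⟨⟨z, Z⟩, hZ, b, ⟨t, X⟩, hX, hc, rfl⟩)
      · exact first k hk q hqn hq
      rintro _ ⟨u, hu, v, hv, rfl⟩ _ ⟨u', hu', v', hv', rfl⟩
      simp only at hqn hc hu hv hu' hv'
      have hz : Below (z * f b * t) z := by rw [mul_assoc]; exact below_mul_right _ _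
      have hzn : {x | Below z x}.ncard ≤ n + 1 :=
        (Set.ncard_le_ncard (fun x hx => hz.trans hx) (Set.toFinite _)).trans hqn
      have htn : {x | Below t x}.ncard ≤ n + 1 :=
        (Set.ncard_le_ncard (fun x hx => (below_mul_left _ _).trans hx) (Set.toFinite _)).trans hqn
      have := (first k hk (z, Z) hzn hZ u hu u' hu').append
        ((first k hk (t, X) htn hX v hv v' hv').append_left [b])
      simpa using this
  obtain ⟨K, hK⟩ := main (Nat.card N)
  refine ⟨K, fun k hk q hq => (hK k hk q ?_).1 hq⟩
  exact Set.ncard_le_card _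

/-- Every language of `UPol C` is a union of classes of any large enough depth. -/
theorem InUPol.exists_subset_classes {C : Set (Language A)} (hf : Function.Surjective (val f))
    (hC : ∀ L ∈ C, Recognizes f L) (hreg : ∀ L ∈ C, L.IsRegular) (h : InUPol C L) :
    ∃ K, ∀ k, K ≤ k → ∀ q ∈ classes f k, ∀ w ∈ q.2, w ∈ L → q.2 ≤ L := by
  obtain ⟨p, hp⟩ := h.exists_absorbs hC
  obtain ⟨M, _, _, g, hg⟩ := exists_recognizes_of_isRegular (h.isRegular hreg)
  obtain ⟨K, hK⟩ := hp.exists_pure hf hg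
  exact ⟨K, fun k hk q hq w hw hwL w' hw' => ((hK k hk q hq w hw w' hw').mem_iff).1 hwL⟩

/-- Covering is tested on the classes of a large enough depth. -/
theorem coverable_iff {C : Set (Language A)} (hf : Function.Surjective (val f))
    (hC : ∀ L ∈ C, Recognizes f L) (hfib : ∀ s, ({w | val f w = s} : Language A) ∈ C)
    (hreg : ∀ L ∈ C, L.IsRegular) (L₁ : Language A) (L₂s : Set (Language A)) :
    Coverable (UPol C) L₁ L₂s ↔ ∃ k, ∀ q ∈ classes f k, (∃ w ∈ q.2, w ∈ L₁) →
      ∃ L ∈ L₂s, ∀ w ∈ q.2, w ∉ L := by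
  constructor
  · rintro ⟨Ks, hfin, hKs, hcov, hsep⟩
    -- The cover is finite, so one depth makes all its members unions of classes. A class that meets
    -- `L₁` then lies inside a single member.
    have : ∃ k, ∀ K ∈ Ks, ∀ q ∈ classes f k, ∀ w ∈ q.2, w ∈ K → q.2 ≤ K := by
      choose! F hF using fun K (hK : K ∈ Ks) =>
        InUPol.exists_subset_classes hf hC hreg (show InUPol C K from hKs hK)
      obtain ⟨k, hk⟩ := (hfin.image F).bddAbove
      exact ⟨k, fun K hK => hF K hK k (hk ⟨K, hK, rfl⟩)⟩
    obtain ⟨k, hk⟩ := this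
    refine ⟨k, fun q hq ⟨w, hw, hw1⟩ => ?_⟩
    obtain ⟨K, hK, hwK⟩ := hcov w hw1
    obtain ⟨L, hL, hKL⟩ := hsep K hK
    refine ⟨L, hL, fun v hv hvL => ?_⟩
    exact Set.eq_empty_iff_forall_notMem.1 hKL v ⟨hk K hK q hq w hw hwK hv, hvL⟩
  · rintro ⟨k, hk⟩
    have hP := isUPolPartition_classes hfib k
    refine ⟨Prod.snd '' {q | q ∈ classes f k ∧ ∃ w ∈ q.2, w ∈ L₁},
      (hP.finite.subset fun q hq => hq.1).image _, ?_, ?_, ?_⟩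
    · rintro _ ⟨q, hq, rfl⟩
      exact hP.upol hq.1
    · intro w hw
      obtain ⟨q, hq, hwq⟩ := hP.cover w
      exact ⟨_, ⟨q, ⟨hq, w, hwq, hw⟩, rfl⟩, hwq⟩
    · rintro _ ⟨q, hq, rfl⟩
      obtain ⟨L, hL, h⟩ := hk q hq.1 hq.2
      exact ⟨L, hL, Set.eq_empty_iff_forall_notMem.2 fun w hw => h w hw.1 hw.2⟩

/-- Separation is covering by a single language. -/
theorem separable_iff_coverable {C : Set (Language A)} (hf : Function.Surjective (val f))
    (hC : ∀ L ∈ C, Recognizes f L) (hfib : ∀ s, ({w | val f w = s} : Language A) ∈ C)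
    (hreg : ∀ L ∈ C, L.IsRegular) (hbot : ⊥ ∈ C) (L₁ L₂ : Language A) :
    Separable (UPol C) L₁ L₂ ↔ Coverable (UPol C) L₁ {L₂} := by
  constructor
  · rintro ⟨K, hK, h1, h2⟩
    refine ⟨{K}, Set.finite_singleton K, by simpa using hK, fun w hw => ⟨K, rfl, h1 hw⟩, ?_⟩
    rintro _ rfl
    exact ⟨L₂, rfl, by rw [inf_comm]; exact h2⟩
  · rw [coverable_iff hf hC hfib hreg]
    rintro ⟨k, hk⟩
    have hP := isUPolPartition_classes hfib k
    refine ⟨_, hP.inUPol_biUnion hbot (Q := {q | q ∈ classes f k ∧ ∃ w ∈ q.2, w ∈ L₁})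
      fun q hq => hq.1, ?_, ?_⟩
    · intro w hw
      obtain ⟨q, hq, hwq⟩ := hP.cover w
      exact ⟨q, ⟨hq, w, hwq, hw⟩, hwq⟩
    · refine Set.eq_empty_iff_forall_notMem.2 ?_
      rintro w ⟨hw2, q, hq, hwq⟩
      obtain ⟨L, rfl, h⟩ := hk q hq.1 hq.2
      exact h w hwq hw2

end Purity

/-! ### Images of the classes and their stabilization -/

section Images

variable {A N M : Type*} [Monoid M] {f : A → N} {g : A → M}

/-- Each member of `P` has its image under `g` included in that of a member of `P'` of the same
value. -/
def ImgLE (g : A → M) (P P' : Set (N × Language A)) : Prop :=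
  ∀ q ∈ P, ∃ q' ∈ P', q'.1 = q.1 ∧ ∀ w ∈ q.2, ∃ w' ∈ q'.2, val g w' = val g w

theorem ImgLE.refl (g : A → M) (P : Set (N × Language A)) : ImgLE g P P :=
  fun q hq => ⟨q, hq, rfl, fun w hw => ⟨w, hw, rfl⟩⟩

theorem ImgLE.trans {P P' P'' : Set (N × Language A)} (h : ImgLE g P P') (h' : ImgLE g P' P'') :
    ImgLE g P P'' := by
  intro q hq
  obtain ⟨q', hq', h1, h2⟩ := h q hq
  obtain ⟨q'', hq'', h3, h4⟩ := h' q' hq'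
  refine ⟨q'', hq'', h3.trans h1, fun w hw => ?_⟩
  obtain ⟨w', hw', e⟩ := h2 w hw
  obtain ⟨w'', hw'', e'⟩ := h4 w' hw'
  exact ⟨w'', hw'', e'.trans e⟩

variable [Monoid N]

/-- Cuts see only the values, and the image of a marked product is the product of the images, so
refinement is monotone. -/
theorem ImgLE.cutRefine {P P' : Set (N × Language A)} (h : ImgLE g P P')
    (c : N → A → N → Prop) : ImgLE g (cutRefine f c P) (cutRefine f c P') := by
  rintro _ (⟨hq, h1⟩ | ⟨r, hr, a, s, hs, hc, rfl⟩)
  · obtain ⟨q', hq', e, h2⟩ := h _ hq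
    exact ⟨q', Or.inl ⟨hq', by rwa [e]⟩, e, h2⟩
  · obtain ⟨r', hr', e1, h1⟩ := h r hr
    obtain ⟨s', hs', e2, h2⟩ := h s hs
    refine ⟨_, Or.inr ⟨r', hr', a, s', hs', by rwa [e1, e2], rfl⟩, by simp [e1, e2], ?_⟩
    rintro _ ⟨u, hu, v, hv, rfl⟩
    obtain ⟨u', hu', e3⟩ := h1 u hu
    obtain ⟨v', hv', e4⟩ := h2 v hv
    exact ⟨_, ⟨u', hu', v', hv', rfl⟩, by simp [e3, e4]⟩

variable [Finite A] [Finite N]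

/-- Depth zero consists of whole fibres, which dominate everything of the same value; monotonicity
of the refinement propagates the comparison. -/
theorem imgLE_classes_succ (k : ℕ) : ImgLE g (classes f (k + 1)) (classes f k) := by
  induction k with
  | zero =>
    intro q hq
    exact ⟨_, ⟨q.1, rfl⟩, rfl, fun w hw => ⟨w, fibre_classes hq hw, rfl⟩⟩
  | succ k ih => exact (ih.cutRefine _).cutRefine _

theorem imgLE_classes {k n : ℕ} (h : k ≤ n) : ImgLE g (classes f n) (classes f k) := by
  induction n, h using Nat.le_induction with
  | base => exact ImgLE.refl _ _
  | succ n _ ih => exact (imgLE_classes_succ n).trans ih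

theorem exists_subset_succ {α : Type*} [Finite α] (D : ℕ → Set α)
    (hD : ∀ k, D (k + 1) ⊆ D k) : ∃ i, i ≤ Nat.card α ∧ D i ⊆ D (i + 1) := by
  by_contra! h
  have : ∀ i, i ≤ Nat.card α + 1 → (D i).ncard + i ≤ Nat.card α := by
    intro i
    induction i with
    | zero => intro _; simpa using Set.ncard_le_card (D 0)
    | succ i ih =>
      intro hi
      have h1 := Set.ncard_lt_ncard ⟨hD i, h i (by omega)⟩ (Set.toFinite _)
      have := ih (by omega)
      omega
  have := this _ le_rfl
  omega

/-- The images of the classes are stable from a depth that depends only on the number of subsets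
of the monoid. -/
theorem imgLE_classes_of_card [Finite M] {K : ℕ} (hK : Nat.card (N × Set M) ≤ K) (k : ℕ) :
    ImgLE g (classes f K) (classes f k) := by
  -- Closing the sets of pairs (value, image) under taking smaller images turns `ImgLE` into
  -- inclusion. A decreasing sequence of subsets of `N × Set M` must repeat within the size of this
  -- type.
  let D : ℕ → Set (N × Set M) := fun k =>
    {x | ∃ q ∈ classes f k, q.1 = x.1 ∧ ∀ m ∈ x.2, ∃ w ∈ q.2, val g w = m}
  obtain ⟨i, hi, h⟩ := exists_subset_succ D (by
    rintro k x ⟨q, hq, h1, h2⟩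
    obtain ⟨q', hq', h3, h4⟩ := imgLE_classes_succ (g := g) k q hq
    refine ⟨q', hq', h3.trans h1, fun m hm => ?_⟩
    obtain ⟨w, hw, rfl⟩ := h2 m hm
    exact h4 w hw)
  have h1 : ImgLE g (classes f i) (classes f (i + 1)) := by
    intro q hq
    obtain ⟨q', hq', h3, h4⟩ := h (show (q.1, {m | ∃ w ∈ q.2, val g w = m}) ∈ D i from
      ⟨q, hq, rfl, fun m hm => hm⟩)
    exact ⟨q', hq', h3, fun w hw => h4 _ ⟨w, hw, rfl⟩⟩
  have h2 : ∀ n, ImgLE g (classes f (i + n)) (classes f (i + n + 1)) := by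
    intro n
    induction n with
    | zero => exact h1
    | succ n ih => exact (ih.cutRefine _).cutRefine _
  have h3 : ∀ n, ImgLE g (classes f i) (classes f (i + n)) := by
    intro n
    induction n with
    | zero => exact ImgLE.refl _ _
    | succ n ih => exact ih.trans (h2 n)
  -- From `K` up to the stable depth `i`, along the stable part to `i + k`, then to `k`.
  exact (imgLE_classes (hi.trans hK)).trans ((h3 k).trans (imgLE_classes (Nat.le_add_left k i)))

end Images

/-- Some member of `P` meets `L₁` and all languages of `L₂s`. -/
def Meets {A N : Type*} (P : Set (N × Language A)) (L₁ : Language A) (L₂s : Set (Language A)) :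
    Prop :=
  ∃ q ∈ P, (∃ w ∈ q.2, w ∈ L₁) ∧ ∀ L ∈ L₂s, ∃ w ∈ q.2, w ∈ L

theorem Meets.of_imgLE {A N M : Type*} [Monoid M] {g : A → M} {P P' : Set (N × Language A)}
    {L₁ : Language A} {L₂s : Set (Language A)} (h : Meets P L₁ L₂s) (hP : ImgLE g P P')
    (h1 : Recognizes g L₁) (h2 : ∀ L ∈ L₂s, Recognizes g L) : Meets P' L₁ L₂s := by
  obtain ⟨q, hq, ⟨w, hw, hwL⟩, hall⟩ := h
  obtain ⟨q', hq', -, himg⟩ := hP q hq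
  refine ⟨q', hq', ?_, fun L hL => ?_⟩
  · obtain ⟨w', hw', e⟩ := himg w hw
    exact ⟨w', hw', (h1 _ _ e).2 hwL⟩
  · obtain ⟨v, hv, hvL⟩ := hall L hL
    obtain ⟨v', hv', e⟩ := himg v hv
    exact ⟨v', hv', (h2 L hL _ _ e).2 hvL⟩

/-! ### Approximation of the classes by finite languages -/

section Lists

variable {A N : Type*} [Monoid N] (f : A → N)

/-- The family of finite languages described by a list. -/
def listFam (l : List (N × List (List A))) : Set (N × Language A) :=
  {q | ∃ r ∈ l, q = (r.1, {w | w ∈ r.2})}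

open Classical in
/-- The operation `cutRefine` on lists; `as` is the list of all letters. -/
noncomputable def listRefine (as : List A) (c : N → A → N → Prop)
    (l : List (N × List (List A))) : List (N × List (List A)) :=
  l.filter (fun r => decide (Below 1 r.1)) ++ l.flatMap fun r => as.flatMap fun a =>
    l.flatMap fun r' => if c r.1 a r'.1 then
      [(r.1 * f a * r'.1, r.2.flatMap fun u => r'.2.map fun v => u ++ a :: v)] else []

theorem listFam_listRefine {as : List A} (has : ∀ a, a ∈ as) (c : N → A → N → Prop)
    (l : List (N × List (List A))) :
    listFam (listRefine f as c l) = cutRefine f c (listFam l) := by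
  classical
  have hprod : ∀ (X Y : List (List A)) (a : A),
      ({w | w ∈ X.flatMap fun u => Y.map fun v => u ++ a :: v} : Language A) =
        markedConcat {w | w ∈ X} a {w | w ∈ Y} := by
    intro X Y a
    apply Set.ext
    intro w
    change w ∈ X.flatMap _ ↔ ∃ u ∈ X, ∃ v ∈ Y, w = u ++ a :: v
    simp only [List.mem_flatMap, List.mem_map, eq_comm]
  apply Set.ext
  intro q
  constructor
  · rintro ⟨r, hr, rfl⟩
    rw [listRefine, List.mem_append] at hr
    rcases hr with hr | hr
    · rw [List.mem_filter, decide_eq_true_iff] at hr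
      exact Or.inl ⟨⟨r, hr.1, rfl⟩, hr.2⟩
    · simp only [List.mem_flatMap] at hr
      obtain ⟨r₁, h1, a, -, r₂, h2, h3⟩ := hr
      split_ifs at h3 with hc
      · rw [List.mem_singleton] at h3
        subst h3
        refine Or.inr ⟨_, ⟨r₁, h1, rfl⟩, a, _, ⟨r₂, h2, rfl⟩, hc, ?_⟩
        rw [← hprod]
        rfl
      · simp at h3
  · rintro (⟨⟨r, hr, rfl⟩, h⟩ | ⟨_, ⟨r₁, h1, rfl⟩, a, _, ⟨r₂, h2, rfl⟩, hc, rfl⟩)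
    · exact ⟨r, List.mem_append_left _ (List.mem_filter.2 ⟨hr, by simpa using h⟩), rfl⟩
    · refine ⟨(r₁.1 * f a * r₂.1, r₁.2.flatMap fun u => r₂.2.map fun v => u ++ a :: v), ?_, ?_⟩
      · rw [listRefine, List.mem_append]
        right
        simp only [List.mem_flatMap]
        exact ⟨r₁, h1, a, has a, r₂, h2, by rw [if_pos hc]; exact List.mem_singleton_self _⟩
      · simp only
        rw [hprod]
        rfl

/-- The list of the words of length at most `n`. -/
def wordsUpTo {A : Type*} (as : List A) : ℕ → List (List A)
  | 0 => [[]]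
  | n + 1 => [] :: (wordsUpTo as n).flatMap fun w => as.map fun a => a :: w

theorem mem_wordsUpTo {A : Type*} {as : List A} (has : ∀ a, a ∈ as) {n : ℕ} {w : List A} :
    w ∈ wordsUpTo as n ↔ w.length ≤ n := by
  induction n generalizing w with
  | zero => simp [wordsUpTo]
  | succ n ih =>
    rcases w with _ | ⟨b, w⟩
    · simp [wordsUpTo]
    · simp [wordsUpTo, ih, has]

open Classical in
/-- The words of length at most `n`, sorted by their values; `ns` is the list of all values. -/
noncomputable def listFibres (as : List A) (ns : List N) (n : ℕ) : List (N × List (List A)) :=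
  ns.map fun s => (s, (wordsUpTo as n).filter fun w => decide (val f w = s))

/-- Approximation of the classes of depth `k` by finite languages. -/
noncomputable def listClasses (as : List A) (ns : List N) (n k : ℕ) : List (N × List (List A)) :=
  (fun l => listRefine f as (cutL f) (listRefine f as (cutR f) l))^[k] (listFibres f as ns n)

variable {f}

/-- In a longer word two prefixes share both values, and the factor between them can be deleted. -/
theorem exists_short {M : Type*} [Finite N] [Monoid M] [Finite M] (g : A → M) (w : List A) :
    ∃ w' : List A, w'.length ≤ Nat.card (M × N) ∧ val g w' = val g w ∧ val f w' = val f w := by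
  induction hn : w.length using Nat.strong_induction_on generalizing w with
  | _ n ih =>
    by_cases h : n ≤ Nat.card (M × N)
    · exact ⟨w, hn ▸ h, rfl, rfl⟩
    · obtain ⟨i, j, hij, hj, heq⟩ := exists_lt_eq_of_card
        (fun i => (val g (w.take i), val f (w.take i))) (n := w.length) (by omega)
      rw [Prod.mk.injEq] at heq
      obtain ⟨w', h1, h2, h3⟩ := ih (w.take i ++ w.drop j).length (by simp; omega) _ rfl
      refine ⟨w', h1, h2.trans ?_, h3.trans ?_⟩
      · rw [val_append, heq.1, ← val_append, List.take_append_drop]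
      · rw [val_append, heq.2, ← val_append, List.take_append_drop]

variable {M : Type*} [Finite N] [Monoid M] [Finite M] {g : A → M} {as : List A} {ns : List N}

/-- Short words already realize all images of the fibres, and refinement preserves both comparisons.
-/
theorem imgLE_listClasses (has : ∀ a, a ∈ as) (hns : ∀ s, s ∈ ns) {n : ℕ}
    (hn : Nat.card (M × N) ≤ n) (k : ℕ) :
    ImgLE g (listFam (listClasses f as ns n k)) (classes f k) ∧
      ImgLE g (classes f k) (listFam (listClasses f as ns n k)) := by
  classical
  induction k with
  | zero =>
    constructor
    · rintro _ ⟨r, hr, rfl⟩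
      obtain ⟨s, -, rfl⟩ := List.mem_map.1 hr
      refine ⟨_, ⟨s, rfl⟩, rfl, fun w hw => ⟨w, ?_, rfl⟩⟩
      have := (List.mem_filter.1 (show w ∈ List.filter _ _ from hw)).2
      change val f w = s
      simpa using this
    · rintro _ ⟨s, rfl⟩
      refine ⟨_, ⟨_, List.mem_map.2 ⟨s, hns s, rfl⟩, rfl⟩, rfl, fun w (hw : val f w = s) => ?_⟩
      obtain ⟨w', h1, h2, h3⟩ := exists_short (f := f) g w
      refine ⟨w', List.mem_filter.2 ⟨(mem_wordsUpTo has).2 (h1.trans hn), ?_⟩, h2⟩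
      simpa using h3.trans hw
  | succ k ih =>
    rw [listClasses, Function.iterate_succ_apply', listFam_listRefine f has,
      listFam_listRefine f has]
    exact ⟨(ih.1.cutRefine _).cutRefine _, (ih.2.cutRefine _).cutRefine _⟩

/-- Covering is tested on finitely many words. -/
theorem coverable_iff_not_meets [Finite A] {C : Set (Language A)}
    (hf : Function.Surjective (val f)) (hC : ∀ L ∈ C, Recognizes f L)
    (hfib : ∀ s, ({w | val f w = s} : Language A) ∈ C) (hreg : ∀ L ∈ C, L.IsRegular)
    (has : ∀ a, a ∈ as) (hns : ∀ s, s ∈ ns) {L₁ : Language A} {L₂s : Set (Language A)}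
    (h1 : Recognizes g L₁) (h2 : ∀ L ∈ L₂s, Recognizes g L) {n K : ℕ}
    (hn : Nat.card (M × N) ≤ n) (hK : Nat.card (N × Set M) ≤ K) :
    Coverable (UPol C) L₁ L₂s ↔ ¬ Meets (listFam (listClasses f as ns n K)) L₁ L₂s := by
  have himg := imgLE_listClasses (f := f) (g := g) has hns hn K
  have hmeets : ∀ k, (∀ q ∈ classes f k, (∃ w ∈ q.2, w ∈ L₁) → ∃ L ∈ L₂s, ∀ w ∈ q.2, w ∉ L) ↔
      ¬ Meets (classes f k) L₁ L₂s := by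
    intro k
    simp only [Meets]
    push Not
    rfl
  rw [coverable_iff hf hC hfib hreg]
  simp only [hmeets]
  constructor
  · rintro ⟨k, hk⟩ h
    exact hk ((h.of_imgLE himg.1 h1 h2).of_imgLE (imgLE_classes_of_card hK k) h1 h2)
  · exact fun h => ⟨K, fun h' => h (h'.of_imgLE himg.2 h1 h2)⟩

end Lists

/-! ### Automaton codes and bounds for their transition monoids -/

section Codes

variable {A : Type*}

/-- The states in which a run of the automaton can be. -/
def NFACode.states (c : NFACode A) : List ℕ := c.2.1 ++ c.1.map fun t => t.2.2

/-- The subset automaton of the automaton described by a code. -/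
def NFACode.toDFA (c : NFACode A) : DFA A (Set {q // q ∈ c.states}) where
  step S a := {q | ∃ p ∈ S, (p.1, a, q.1) ∈ c.1}
  start := {q | q.1 ∈ c.2.1}
  accept := {S | ∃ q ∈ S, q.1 ∈ c.2.2}

theorem NFACode.evalFrom_toDFA (c : NFACode A) (S : Set {q // q ∈ c.states}) (w : List A) :
    Subtype.val '' c.toDFA.evalFrom S w = c.toNFA.evalFrom (Subtype.val '' S) w := by
  induction w generalizing S with
  | nil => rfl
  | cons a w ih =>
    rw [DFA.evalFrom_cons, ih, NFA.evalFrom_cons]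
    congr 1
    ext q
    rw [NFA.mem_stepSet]
    constructor
    · rintro ⟨q, ⟨p, hp, h⟩, rfl⟩
      exact ⟨p.1, ⟨p, hp, rfl⟩, h⟩
    · rintro ⟨_, ⟨p, hp, rfl⟩, h⟩
      exact ⟨⟨q, List.mem_append_right _ (List.mem_map.2 ⟨_, h, rfl⟩)⟩, ⟨p, hp, h⟩, rfl⟩

theorem NFACode.accepts_toDFA (c : NFACode A) : c.toDFA.accepts = c.lang := by
  apply Set.ext
  intro w
  have hstart : Subtype.val '' c.toDFA.start = c.toNFA.start := by
    ext q
    constructor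
    · rintro ⟨q, hq, rfl⟩
      exact hq
    · exact fun h => ⟨⟨q, List.mem_append_left _ h⟩, h, rfl⟩
  change c.toDFA.evalFrom c.toDFA.start w ∈ c.toDFA.accept ↔ w ∈ c.toNFA.accepts
  rw [NFA.mem_accepts, ← hstart, ← NFACode.evalFrom_toDFA]
  constructor
  · rintro ⟨q, hq, h⟩
    exact ⟨q.1, h, q, hq, rfl⟩
  · rintro ⟨_, h, q, hq, rfl⟩
    exact ⟨q, hq, h⟩

/-- A bound for the size of the transition monoid of the subset automaton of a code. -/
def NFACode.bound (c : NFACode A) : ℕ := (2 ^ c.states.length) ^ 2 ^ c.states.length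

theorem NFACode.exists_monoid (c : NFACode A) :
    ∃ (M : Type) (_ : Monoid M) (_ : Finite M) (g : A → M),
      Recognizes g c.lang ∧ Nat.card M ≤ c.bound := by
  refine ⟨_, inferInstance, inferInstance, dfaMor c.toDFA, ?_, ?_⟩
  · rw [← c.accepts_toDFA]
    exact recognizes_dfaMor _
  · have h1 : Nat.card {q // q ∈ c.states} ≤ c.states.length := by
      classical
      rw [Nat.card_eq_fintype_card, Fintype.card_of_subtype c.states.toFinset (by simp)]
      exact List.toFinset_card_le _
    have h2 : Nat.card (Set {q // q ∈ c.states}) ≤ 2 ^ c.states.length := by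
      rw [Nat.card_eq_fintype_card, Fintype.card_set, ← Nat.card_eq_fintype_card]
      exact Nat.pow_le_pow_right (by norm_num) h1
    have h3 : Nat.card (Function.End (Set {q // q ∈ c.states}))ᵐᵒᵖ =
        Nat.card (Set {q // q ∈ c.states} → Set {q // q ∈ c.states}) :=
      Nat.card_congr MulOpposite.opEquiv.symm
    rw [h3, Nat.card_fun]
    exact (Nat.pow_le_pow_left h2 _).trans (Nat.pow_le_pow_right (by positivity) h2)

/-- The product of the bounds of a list of codes. -/
def codesBound (cs : List (NFACode A)) : ℕ := cs.foldr (fun c b => c.bound * b) 1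

/-- The product monoid recognizes all inputs at once. The algorithm never constructs it: only the
bound on its size is used, to choose a word length and a depth. -/
theorem exists_monoid_of_codes (cs : List (NFACode A)) :
    ∃ (M : Type) (_ : Monoid M) (_ : Finite M) (g : A → M),
      (∀ c ∈ cs, Recognizes g c.lang) ∧ Nat.card M ≤ codesBound cs := by
  induction cs with
  | nil => exact ⟨Unit, inferInstance, inferInstance, fun _ => 1, by simp, by simp [codesBound]⟩
  | cons c cs ih =>
    obtain ⟨M, _, _, g, hg, hM⟩ := ih
    obtain ⟨M', _, _, g', hg', hM'⟩ := c.exists_monoid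
    refine ⟨M' × M, inferInstance, inferInstance, fun a => (g' a, g a), ?_, ?_⟩
    · intro d hd u v huv
      rw [val_prod, val_prod, Prod.mk.injEq] at huv
      rcases List.mem_cons.1 hd with rfl | hd
      · exact hg' u v huv.1
      · exact hg d hd u v huv.2
    · rw [Nat.card_prod]
      exact Nat.mul_le_mul hM' hM

open Classical in
/-- The list of the successors of a list of states. -/
noncomputable def NFACode.stepList (c : NFACode A) (S : List ℕ) (a : A) : List ℕ :=
  c.1.flatMap fun t => if t.1 ∈ S ∧ t.2.1 = a then [t.2.2] else []

theorem NFACode.mem_foldl_stepList (c : NFACode A) (w : List A) (S : List ℕ) (q : ℕ) :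
    q ∈ w.foldl c.stepList S ↔ q ∈ c.toNFA.evalFrom {q | q ∈ S} w := by
  induction w generalizing S with
  | nil => rfl
  | cons a w ih =>
    rw [List.foldl_cons, ih, NFA.evalFrom_cons]
    have : {q | q ∈ c.stepList S a} = c.toNFA.stepSet {q | q ∈ S} a := by
      ext q
      rw [NFA.mem_stepSet]
      change q ∈ c.stepList S a ↔ ∃ p ∈ S, (p, a, q) ∈ c.1
      simp only [NFACode.stepList, List.mem_flatMap]
      constructor
      · rintro ⟨⟨p, b, r⟩, ht, h⟩
        split_ifs at h with hc
        · obtain ⟨hp, rfl⟩ := hc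
          obtain rfl := List.mem_singleton.1 h
          exact ⟨p, hp, ht⟩
        · simp at h
      · rintro ⟨p, hp, ht⟩
        exact ⟨_, ht, by simp [hp]⟩
    rw [this]

end Codes

/-! ### Primitive recursiveness of the test -/

section Computability

open Primrec

variable {A : Type*} [Primcodable A]

theorem primrec_pow : Primrec₂ ((· ^ ·) : ℕ → ℕ → ℕ) := Primrec₂.unpaired'.1 Nat.Primrec.pow

theorem primrecPred_exists_mem {α β : Type*} [Primcodable α] [Primcodable β] {l : α → List β}
    {R : α → β → Prop} (hl : Primrec l) (hR : PrimrecRel R) :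
    PrimrecPred fun a => ∃ b ∈ l a, R a b :=
  hR.swap.exists_mem_list.comp hl Primrec.id

theorem primrecPred_forall_mem {α β : Type*} [Primcodable α] [Primcodable β] {l : α → List β}
    {R : α → β → Prop} (hl : Primrec l) (hR : PrimrecRel R) :
    PrimrecPred fun a => ∀ b ∈ l a, R a b :=
  hR.swap.forall_mem_list.comp hl Primrec.id

theorem primrecRel_mem {β : Type*} [Primcodable β] :
    PrimrecRel fun (b : β) (l : List β) => b ∈ l :=
  (primrecPred_exists_mem (l := fun x : β × List β => x.2) (R := fun x b => x.1 = b) snd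
    (Primrec.eq.comp (fst.comp fst) snd)).of_eq fun x => by simp

theorem primrec_val {N : Type*} [Monoid N] [Primcodable N] [Finite A] [Finite N] (f : A → N) :
    Primrec (val f) := by
  have hmul : Primrec fun x : A × N => f x.1 * x.2 := Primrec.dom_finite _
  refine (list_foldr (h := fun _ x => f x.1 * x.2) Primrec.id (const (1 : N))
    (hmul.comp snd).to₂).of_eq fun w => ?_
  induction w with
  | nil => simp
  | cons a w ih => rw [val_cons, ← ih]; rfl

theorem NFACode.primrecRel_mem_lang :
    PrimrecRel fun (w : List A) (c : NFACode A) => w ∈ c.lang := by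
  classical
  have hstep : Primrec fun x : NFACode A × List ℕ × A => x.1.stepList x.2.1 x.2.2 := by
    refine list_flatMap (fst.comp fst) (Primrec.ite ?_ ?_ (const []))
    · exact (primrecRel_mem.comp (fst.comp snd) (fst.comp (snd.comp fst))).and
        (Primrec.eq.comp (fst.comp (snd.comp snd)) (snd.comp (snd.comp fst)))
    · exact list_cons.comp (snd.comp (snd.comp snd)) (const [])
  have hfold : Primrec fun x : List A × NFACode A => x.1.foldl x.2.stepList x.2.2.1 :=
    list_foldl (h := fun (x : List A × NFACode A) (y : List ℕ × A) => x.2.stepList y.1 y.2)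
      fst (fst.comp (snd.comp snd)) (hstep.comp (pair (snd.comp fst) snd)).to₂
  refine (primrecPred_exists_mem (R := fun (x : List A × NFACode A) q => q ∈ x.2.2.2) hfold
    (primrecRel_mem.comp snd (snd.comp (snd.comp (snd.comp fst))))).of_eq ?_
  rintro ⟨w, c⟩
  change (∃ q ∈ w.foldl c.stepList c.2.1, q ∈ c.2.2) ↔ w ∈ c.toNFA.accepts
  rw [NFA.mem_accepts]
  simp only [NFACode.mem_foldl_stepList]
  constructor
  · rintro ⟨q, h, h'⟩
    exact ⟨q, h', h⟩
  · rintro ⟨q, h', h⟩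
    exact ⟨q, h, h'⟩

theorem primrec_codesBound : Primrec (codesBound : List (NFACode A) → ℕ) := by
  have hlen : Primrec fun c : NFACode A => c.states.length :=
    list_length.comp (list_append.comp (fst.comp snd)
      (list_map fst (snd.comp (snd.comp snd)).to₂))
  have hpow : Primrec fun c : NFACode A => 2 ^ c.states.length := primrec_pow.comp (const 2) hlen
  have hbound : Primrec fun c : NFACode A => c.bound := primrec_pow.comp hpow hpow
  exact list_foldr (h := fun _ (x : NFACode A × ℕ) => x.1.bound * x.2) Primrec.id (const 1)
    (nat_mul.comp (hbound.comp (fst.comp snd)) (snd.comp snd)).to₂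

theorem primrec_wordsUpTo (as : List A) : Primrec (wordsUpTo as) := by
  have h : Primrec fun l : List (List A) => [] :: l.flatMap fun w => as.map fun a => a :: w :=
    list_cons.comp (const []) (list_flatMap Primrec.id
      (list_map (const as) (list_cons.comp snd (snd.comp fst)).to₂).to₂)
  refine (nat_rec₁ [[]] (h.comp snd).to₂).of_eq fun n => ?_
  induction n with
  | zero => rfl
  | succ n ih => rw [wordsUpTo, ← ih]

theorem primrecPred_meets {α N : Type*} [Primcodable α] [Primcodable N] {l : α → List (N × List (List A))}
    {c : α → NFACode A} {cs : α → List (NFACode A)} (hl : Primrec l) (hc : Primrec c)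
    (hcs : Primrec cs) :
    PrimrecPred fun x => Meets (listFam (l x)) (c x).lang {L | ∃ d ∈ cs x, d.lang = L} := by
  have hmeet : PrimrecRel fun (X : List (List A)) (d : NFACode A) => ∃ w ∈ X, w ∈ d.lang :=
    primrecPred_exists_mem fst (NFACode.primrecRel_mem_lang.comp snd (snd.comp fst))
  refine (primrecPred_exists_mem (R := fun x (r : N × List (List A)) =>
    (∃ w ∈ r.2, w ∈ (c x).lang) ∧ ∀ d ∈ cs x, ∃ w ∈ r.2, w ∈ d.lang) hl ?_).of_eq ?_
  · exact (hmeet.comp (snd.comp snd) (hc.comp fst)).and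
      (primrecPred_forall_mem (hcs.comp fst) (hmeet.comp (snd.comp (snd.comp fst)) snd))
  · intro x
    constructor
    · rintro ⟨r, hr, h1, h2⟩
      refine ⟨_, ⟨r, hr, rfl⟩, h1, ?_⟩
      rintro _ ⟨d, hd, rfl⟩
      exact h2 d hd
    · rintro ⟨_, ⟨r, hr, rfl⟩, h1, h2⟩
      exact ⟨r, hr, h1, fun d hd => h2 _ ⟨d, hd, rfl⟩⟩

/-- Separation reduces to covering by a list of length one. -/
theorem separationDecidable_of_coveringDecidable {D : Set (Language A)}
    (hD : ∀ L₁ L₂, Separable D L₁ L₂ ↔ Coverable D L₁ {L₂}) (h : CoveringDecidable D) :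
    SeparationDecidable D := by
  have hcomp : Computable fun p : NFACode A × NFACode A => (p.1, [p.2]) :=
    (fst.pair (list_cons.comp snd (const []))).to_comp
  obtain ⟨b, hb, e⟩ := ComputablePred.computable_iff.1 h
  refine ComputablePred.computable_iff.2 ⟨fun p => b (p.1, [p.2]), hb.comp hcomp, funext fun p => ?_⟩
  have h1 : {L | ∃ c ∈ [p.2], NFACode.lang c = L} = {p.2.lang} := by
    ext L
    simp [eq_comm]
  rw [hD, ← h1]
  exact congrFun e (p.1, [p.2])

variable [Finite A] {N : Type*} [Monoid N] [Finite N] [Primcodable N]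

theorem primrecPred_of_finite {α : Type*} [Finite α] [Primcodable α] (p : α → Prop) :
    PrimrecPred p := by
  classical
  exact Primrec.primrecPred (Primrec.dom_finite _)

theorem primrec_listFibres (f : A → N) (as : List A) (ns : List N) :
    Primrec (listFibres f as ns) := by
  classical
  have hval : PrimrecRel fun (w : List A) (s : N) => val f w = s :=
    Primrec.eq.comp ((primrec_val f).comp fst) snd
  exact list_map (const ns) (pair snd
    (hval.listFilter.comp ((primrec_wordsUpTo as).comp fst) snd)).to₂

theorem primrec_listRefine (f : A → N) (as : List A) (c : N → A → N → Prop) :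
    Primrec (listRefine f as c) := by
  classical
  have hunit : PrimrecPred fun r : N × List (List A) => Below 1 r.1 :=
    (primrecPred_of_finite fun s : N => Below 1 s).comp fst
  have hc : PrimrecPred fun x : N × A × N => c x.1 x.2.1 x.2.2 := primrecPred_of_finite _
  have hmul : Primrec fun x : N × A × N => x.1 * f x.2.1 * x.2.2 := Primrec.dom_finite _
  have hcat : Primrec fun x : List (List A) × A × List (List A) =>
      x.1.flatMap fun u => x.2.2.map fun v => u ++ x.2.1 :: v :=
    list_flatMap fst (list_map (snd.comp (snd.comp fst)) (list_append.comp (snd.comp fst)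
      (list_cons.comp (fst.comp (snd.comp (fst.comp fst))) snd)).to₂).to₂
  have hbody : Primrec fun x : (N × List (List A)) × A × (N × List (List A)) =>
      if c x.1.1 x.2.1 x.2.2.1 then [(x.1.1 * f x.2.1 * x.2.2.1,
        x.1.2.flatMap fun u => x.2.2.2.map fun v => u ++ x.2.1 :: v)] else [] := by
    have harg : Primrec fun x : (N × List (List A)) × A × (N × List (List A)) =>
        (x.1.1, x.2.1, x.2.2.1) :=
      pair (fst.comp fst) (pair (fst.comp snd) (fst.comp (snd.comp snd)))
    refine Primrec.ite (hc.comp harg) (list_cons.comp (pair (hmul.comp harg) ?_) (const []))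
      (const [])
    exact hcat.comp (pair (snd.comp fst) (pair (fst.comp snd) (snd.comp (snd.comp snd))))
  have h₁ : Primrec fun x : (List (N × List (List A)) × (N × List (List A))) × A =>
      x.1.1.flatMap fun r' => if c x.1.2.1 x.2 r'.1 then [(x.1.2.1 * f x.2 * r'.1,
        x.1.2.2.flatMap fun u => r'.2.map fun v => u ++ x.2 :: v)] else [] :=
    list_flatMap (fst.comp fst)
      (hbody.comp (pair (snd.comp (fst.comp fst)) (pair (snd.comp fst) snd))).to₂
  have h₂ : Primrec fun x : List (N × List (List A)) × (N × List (List A)) =>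
      as.flatMap fun a => x.1.flatMap fun r' => if c x.2.1 a r'.1 then [(x.2.1 * f a * r'.1,
        x.2.2.flatMap fun u => r'.2.map fun v => u ++ a :: v)] else [] :=
    list_flatMap (const as) h₁.to₂
  exact list_append.comp (Primrec.listFilter hunit) (list_flatMap Primrec.id h₂.to₂)

theorem primrec_listClasses (f : A → N) (as : List A) (ns : List N) :
    Primrec₂ (listClasses f as ns) :=
  nat_iterate snd ((primrec_listFibres f as ns).comp fst)
    (((primrec_listRefine f as _).comp (primrec_listRefine f as _)).comp snd).to₂

/-- Covering is decidable for the unambiguous polynomial closure of a class that contains the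
fibres of a morphism onto a finite monoid and consists of languages recognized by it. -/
theorem coveringDecidable_of_morphism {C : Set (Language A)} {f : A → N}
    (hf : Function.Surjective (val f)) (hC : ∀ L ∈ C, Recognizes f L)
    (hfib : ∀ s, ({w | val f w = s} : Language A) ∈ C) (hreg : ∀ L ∈ C, L.IsRegular) :
    CoveringDecidable (UPol C) := by
  have := Fintype.ofFinite A
  have := Fintype.ofFinite N
  let as := (Finset.univ : Finset A).toList
  let ns := (Finset.univ : Finset N).toList
  let m : NFACode A × List (NFACode A) → ℕ := fun x => codesBound (x.1 :: x.2)
  have hm : Primrec m := primrec_codesBound.comp (list_cons.comp fst snd)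
  -- The word length dominates `Nat.card (M × N)` and the depth dominates `Nat.card (N × Set M)`,
  -- for every `M` of size at most `m x`.
  have hl : Primrec fun x => listClasses f as ns (m x * Nat.card N) (Nat.card N * 2 ^ m x) :=
    (primrec_listClasses f as ns).comp (nat_mul.comp hm (const _))
      (nat_mul.comp (const _) (primrec_pow.comp (const 2) hm))
  refine PrimrecPred.computablePred ((primrecPred_meets hl fst snd).not.of_eq ?_)
  rintro ⟨c, cs⟩
  obtain ⟨M, _, _, g, hg, hM⟩ := exists_monoid_of_codes (c :: cs)
  refine (coverable_iff_not_meets (g := g) hf hC hfib hreg (by simp [as]) (by simp [ns])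
    (hg c List.mem_cons_self) ?_ ?_ ?_).symm
  · rintro _ ⟨d, hd, rfl⟩
    exact hg d (List.mem_cons_of_mem _ hd)
  · rw [Nat.card_prod]
    exact Nat.mul_le_mul_right _ hM
  · have : Nat.card (Set M) = 2 ^ Nat.card M := by
      have := Fintype.ofFinite M
      rw [Nat.card_eq_fintype_card, Fintype.card_set, Nat.card_eq_fintype_card]
    rw [Nat.card_prod, this]
    exact Nat.mul_le_mul_left _ (Nat.pow_le_pow_right (by norm_num) hM)

end Computability

end UPolCov

theorem mainTheorem7 {A : Type*} [Finite A] [Primcodable A] (C : Set (Language A))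
    (hC : UPolCov.IsPrevariety C) (hfin : C.Finite) :
    UPolCov.CoveringDecidable (UPolCov.UPol C) ∧
      UPolCov.SeparationDecidable (UPolCov.UPol C) := by
  obtain ⟨N, _, _, f, hf, hrec, hfib⟩ := UPolCov.exists_monoid_of_isPrevariety hC hfin
  -- Any coding of `N` will do, since all functions on a finite type are primitive recursive.
  let _ : Primcodable N := Primcodable.ofEquiv (Fin (Nat.card N)) (Finite.equivFin N)
  have hcov := UPolCov.coveringDecidable_of_morphism hf hrec hfib hC.regular
  exact ⟨hcov, UPolCov.separationDecidable_of_coveringDecidable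
    (UPolCov.separable_iff_coverable hf hrec hfib hC.regular hC.empty_mem) hcov⟩
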